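/- Let $\mathbb F$ be a field, let $n\ge 0$, and let $f=\sum_{S\subseteq[n]}a_S\prod_{i\in[n]\setminus S}x_i\in\mathbb F[x_1,\dots,x_n]$ be a multiaffine polynomial with coefficient vector $\mathbf a=(a_S)_{S\subseteq[n]}\in\mathbb F^{2^n}$. Say that $f$ is determinantal if $$f=\lambda\det\Bigl(\sum_{i=1}^n x_iv_iv_i^T+W\Bigr)$$ for some $m\ge 0$, some $\lambda\in\mathbb F$, some $v_1,\dots,v_n\in\mathbb F^m$ and some symmetric $W\in\mathbb F^{m\times m}$. Consider the conditions (i) for all distinct $i,j\in[n]$ and all $S\subseteq[n]\setminus\{i,j\}$, $a_{S\cup i}a_{S\cup j}-a_Sa_{S\cup ij}$ is a square in $\mathbb F$; (ii) for every $\gamma\in \mathrm{SL}_2(\mathbb F)^n\rtimes S_n$, $(\gamma\cdot\mathrm{HypDet})(\mathbf a)=0$ (an empty condition if $n<3$). If $f$ is determinantal, then (i) and (ii) hold. Conversely, if $|\mathbb F|\neq 3$ and (i) and (ii) hold, then $f$ is determinantal. In particular, if $|\mathbb F|\ne 3$, then $f$ is determinantal if and only if (i) and (ii) hold. Here $\mathrm{HypDet}$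 is Cayley's $2\times2\times2$ hyperdeterminant in the coordinates $a_S$, $S\subseteq\{1,2,3\}$, $$\begin{aligned}\mathrm{HypDet}(\mathbf a)={}&a_\emptyset^2a_{123}^2+a_1^2a_{23}^2+a_2^2a_{13}^2+a_3^2a_{12}^2-2a_\emptyset a_1a_{23}a_{123}-2a_\emptyset a_2a_{13}a_{123}-2a_\emptyset a_3a_{12}a_{123}\\&-2a_1a_2a_{13}a_{23}-2a_1a_3a_{12}a_{23}-2a_2a_3a_{12}a_{13}+4a_\emptyset a_{23}a_{13}a_{12}+4a_{123}a_1a_2a_3,\end{aligned}$$ and $(\gamma\cdot\mathrm{HypDet})(\mathbf a)=\mathrm{HypDet}(\gamma\cdot\mathbf a)$, where $\gamma\cdot\mathbf a$ is the vector of coefficients (of $\prod_{i\in[n]\setminus S}x_i$, $S\subseteq[n]$) of $\gamma\cdot f$. A permutation $\pi\in S_n$ acts on multiaffine polynomials by $\pi\cdot f=f(x_{\pi(1)},\dots,x_{\pi(n)})$, a tuple $\gamma=(\gamma_i)_{i\in[n]}\in\mathrm{SL}_2(\mathbb F)^n$ with $\gamma_i=\begin{pmatrix}\alpha_i&\beta_i\\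 \gamma_i'&\delta_i\end{pmatrix}$ acts by $$\gamma\cdot f=\prod_{i=1}^n(\gamma_i'x_i+\delta_i)\cdot f\Bigl(\frac{\alpha_1x_1+\beta_1}{\gamma_1'x_1+\delta_1},\dots,\frac{\alpha_nx_n+\beta_n}{\gamma_n'x_n+\delta_n}\Bigr),$$ and the pair $(\gamma,\pi)$ acts by $\gamma\cdot(\pi\cdot f)$. -/

import Mathlib

namespace MultiaffineDet

noncomputable section

/-- The multiaffine polynomial `f_a = ∑_S a_S x^{[n] ∖ S}` with coefficient vector `a`. -/
def multiaffinePoly {F : Type*} [Field F] {n : ℕ} (a : Finset (Fin n) → F) :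
    MvPolynomial (Fin n) F :=
  ∑ S : Finset (Fin n), MvPolynomial.C (a S) * ∏ i ∈ Sᶜ, MvPolynomial.X i

/-- The vector `(a_S)_S` where `a_S` is the coefficient of `x^{[n] ∖ S}` in `f`. -/
def coeffVec {F : Type*} [Field F] {n : ℕ} (f : MvPolynomial (Fin n) F) :
    Finset (Fin n) → F :=
  fun S => MvPolynomial.coeff (∑ i ∈ Sᶜ, Finsupp.single i 1) f

/-- `f = lam * det (∑ i, x_i v_i v_iᵀ + W)` for some scalar `lam`, some size `m`, some vectors
`v_1, …, v_n` in `F ^ m` and some symmetric `m × m` matrix `W` over `F`. -/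
def IsDeterminantal {F : Type*} [Field F] {n : ℕ} (f : MvPolynomial (Fin n) F) : Prop :=
  ∃ (m : ℕ) (lam : F) (v : Fin n → Fin m → F) (W : Matrix (Fin m) (Fin m) F),
    W.IsSymm ∧
      f = MvPolynomial.C lam *
        Matrix.det
          (∑ i, (MvPolynomial.X i : MvPolynomial (Fin n) F) •
              (Matrix.vecMulVec (v i) (v i)).map MvPolynomial.C
            + W.map MvPolynomial.C)

/-- The group `SL_2(F)^n ⋊ S_n`, where `S_n` permutes the `n` factors. -/
abbrev ActingGroup (F : Type*) [Field F] (n : ℕ) : Type _ :=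
  SemidirectProduct (Fin n → Matrix.SpecialLinearGroup (Fin 2) F) (Equiv.Perm (Fin n))
    (mulAutArrow (G := Equiv.Perm (Fin n)) (A := Fin n)
      (M := Matrix.SpecialLinearGroup (Fin 2) F))

/-- For `γ_i = (a_i, b_i; c_i, d_i)` and multiaffine `f`, the polynomial
`γ · f = ∏ i, (c_i x_i + d_i) * f ((a_i x_i + b_i) / (c_i x_i + d_i))_i`,
with the denominators cleared monomial by monomial. It is only used for polynomials of degree at
most one in each variable, so that the subtraction in the exponent is a true one. -/
def slAct {F : Type*} [Field F] {n : ℕ} (γ : Fin n → Matrix.SpecialLinearGroup (Fin 2) F)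
    (f : MvPolynomial (Fin n) F) : MvPolynomial (Fin n) F :=
  ∑ α ∈ f.support, MvPolynomial.C (MvPolynomial.coeff α f) *
    ∏ i, ((MvPolynomial.C ((γ i).1 0 0) * MvPolynomial.X i + MvPolynomial.C ((γ i).1 0 1)) ^ (α i) *
      (MvPolynomial.C ((γ i).1 1 0) * MvPolynomial.X i + MvPolynomial.C ((γ i).1 1 1)) ^ (1 - α i))

/-- `π · f = f (x_{π(1)}, …, x_{π(n)})`. -/
def permAct {F : Type*} [Field F] {n : ℕ} (π : Equiv.Perm (Fin n))
    (f : MvPolynomial (Fin n) F) : MvPolynomial (Fin n) F :=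
  MvPolynomial.rename π f

/-- The image of a coefficient vector `a` under `g = (γ, π)`, given by
`f_{g · a} = γ · (π · f_a)`. -/
def actVec {F : Type*} [Field F] {n : ℕ} (g : ActingGroup F n) (a : Finset (Fin n) → F) :
    Finset (Fin n) → F :=
  coeffVec (slAct g.left (permAct g.right (multiaffinePoly a)))

/-- Cayley's `2 × 2 × 2` hyperdeterminant in the eight coordinates `a_S` with `S ⊆ {1, 2, 3}`;
the elements `1, 2, 3` of `[n]` are `0, 1, 2` in `Fin n`. -/
def hypDet {F : Type*} [Field F] {n : ℕ} (h : 3 ≤ n) (a : Finset (Fin n) → F) : F :=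
  let i : Fin n := ⟨0, by omega⟩
  let j : Fin n := ⟨1, by omega⟩
  let k : Fin n := ⟨2, by omega⟩
  (a ∅) ^ 2 * (a {i, j, k}) ^ 2 + (a {i}) ^ 2 * (a {j, k}) ^ 2
    + (a {j}) ^ 2 * (a {i, k}) ^ 2 + (a {k}) ^ 2 * (a {i, j}) ^ 2
    - 2 * a ∅ * a {i} * a {j, k} * a {i, j, k}
    - 2 * a ∅ * a {j} * a {i, k} * a {i, j, k}
    - 2 * a ∅ * a {k} * a {i, j} * a {i, j, k}
    - 2 * a {i} * a {j} * a {i, k} * a {j, k}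
    - 2 * a {i} * a {k} * a {i, j} * a {j, k}
    - 2 * a {j} * a {k} * a {i, j} * a {i, k}
    + 4 * a ∅ * a {j, k} * a {i, k} * a {i, j}
    + 4 * a {i, j, k} * a {i} * a {j} * a {k}

/-- The polynomial function `g · Φ`, where `(g · Φ)(a) = Φ (g · a)`. -/
def actFun {F : Type*} [Field F] {n : ℕ} (g : ActingGroup F n)
    (Φ : (Finset (Fin n) → F) → F) : (Finset (Fin n) → F) → F :=
  fun a => Φ (actVec g a)

/-- Every `a_{S ∪ i} a_{S ∪ j} - a_S a_{S ∪ ij}`, for distinct `i, j` outside `S`, is a square. -/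
def SquareCondition {F : Type*} [Field F] {n : ℕ} (a : Finset (Fin n) → F) : Prop :=
  ∀ i j : Fin n, i ≠ j → ∀ S : Finset (Fin n), i ∉ S → j ∉ S →
    IsSquare (a (insert i S) * a (insert j S) - a S * a (insert i (insert j S)))

/-- All images of the hyperdeterminant under `SL_2(F)^n ⋊ S_n` vanish at `a`.
For `n < 3` there is no hyperdeterminant and the condition is empty. -/
def HypDetCondition {F : Type*} [Field F] {n : ℕ} (a : Finset (Fin n) → F) : Prop :=
  ∀ (h : 3 ≤ n) (g : ActingGroup F n), actFun g (hypDet h) a = 0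

end

end MultiaffineDet

/-! The link between both sides is the Rayleigh difference `Δ_ij f = ∂_i f ∂_j f - f ∂_i ∂_j f`: the
conditions say that all these are squares, and being determinantal says the same.

Necessity. For `f = λ det N(x)`, Dodgson condensation (`dodgson`) makes `Δ_ij f` the square of `λ
v_iᵀ adj(N) v_j`, with `N` taken at `x_i = x_j = 0`. Bordering the pencil (`HasPencil.erase`) keeps
the determinantal form when slots of the multihomogenization of `f` are frozen at arbitrary points.
Freezing all slots but `i, j` at `(1, 0)` or `(0, 1)` gives (i). Freezing all but `i, j, k` gives a
square in `F[x_k]` of degree at most two, whose discriminant, the hyperdeterminant of the `2 × 2 ×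
2` tensor in the slots `i, j, k`, must vanish. By `SL_2`-invariance, (ii) says exactly that all
these tensors have hyperdeterminant zero (`hypDetCondition_iff`).

Sufficiency, first half (`isSquare_rayleigh_of_conditions`). Slots are freed one at a time. As a
binary quadratic form in the new slot, `Δ_ij` has outer coefficients `g²` and `h²` and discriminant
zero, so it is `(g x ± h y)²`. The discriminant has to vanish over extension rings too; this is
where `|F| ≠ 3` enters, since a quartic needs five zeros. Characteristic 2 is handled separately.

Second half (`isDeterminantal_of_rayleigh`). A rotation of slots makes the coefficient of `x_1 ⋯
x_n` nonzero, and factoring reduces to irreducible `f`. Modulo `f` one has `Δ_ij ≡ ∂_i f ∂_j f`, so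
the signs of the roots can be chosen to make the symmetric matrix `G`, with diagonal `∂_i f` and
off-diagonal entries `±√Δ_ij`, of rank one modulo `f`. If `G` has size `k + 2`, then `f^k` divides
`adj G`. Degree counts show that `M = adj G / f^k` has constant off-diagonal entries and diagonal
entries `c x_i + A_ii` with a common constant `c`, and that `det M = c^(k+1) f`. This is the
representation sought. -/

namespace MultiaffineDet

/-! ### Multihomogenization and the group action on coefficient vectors -/

open MvPolynomial Function

noncomputable section

variable {F : Type*} [Field F] {n : ℕ}

/-- The multihomogenization of `f_a`, evaluated at a point of `(R × R) ^ n`. -/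
def ev {R : Type*} [CommRing R] [Algebra F R] (a : Finset (Fin n) → F) (P : Fin n → R × R) : R :=
  ∑ S : Finset (Fin n), algebraMap F R (a S) * ∏ i, if i ∈ S then (P i).2 else (P i).1

section Ev

variable {R : Type*} [CommRing R] [Algebra F R] (a : Finset (Fin n) → F)

theorem prod_ite_update (S : Finset (Fin n)) (P : Fin n → R × R) (i : Fin n) (z : R × R) :
    (∏ k, if k ∈ S then (update P i z k).2 else (update P i z k).1) =
      (if i ∈ S then z.2 else z.1) *
        ∏ k ∈ Finset.univ.erase i, if k ∈ S then (P k).2 else (P k).1 := by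
  rw [← Finset.mul_prod_erase Finset.univ _ (Finset.mem_univ i)]
  congr 1
  · simp
  · refine Finset.prod_congr rfl fun k hk => ?_
    rw [update_of_ne (Finset.ne_of_mem_erase hk)]

theorem ev_update_smul_add (P : Fin n → R × R) (i : Fin n) (c d : R) (z w : R × R) :
    ev a (update P i (c • z + d • w)) = c * ev a (update P i z) + d * ev a (update P i w) := by
  simp only [ev, Finset.mul_sum, prod_ite_update, ← Finset.sum_add_distrib]
  refine Finset.sum_congr rfl fun S _ => ?_
  split_ifs <;> simp <;> ring

theorem ev_update (P : Fin n → R × R) (i : Fin n) (x y : R) :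
    ev a (update P i (x, y)) = x * ev a (update P i (1, 0)) + y * ev a (update P i (0, 1)) := by
  rw [← ev_update_smul_add]
  simp

theorem ev_map {R' : Type*} [CommRing R'] [Algebra F R'] (φ : R →ₐ[F] R') (P : Fin n → R × R) :
    φ (ev a P) = ev a (fun i => (φ (P i).1, φ (P i).2)) := by
  simp only [ev, map_sum, map_mul, map_prod, AlgHom.commutes]
  refine Finset.sum_congr rfl fun S _ => ?_
  congr 1
  refine Finset.prod_congr rfl fun i _ => ?_
  split_ifs <;> rfl

/-- The point all of whose slots are `(1, 0)` or `(0, 1)`, the latter on `S`. -/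
def corner (R : Type*) [CommRing R] (S : Finset (Fin n)) : Fin n → R × R :=
  fun i => if i ∈ S then (0, 1) else (1, 0)

theorem ev_corner (S : Finset (Fin n)) : ev a (corner R S) = algebraMap F R (a S) := by
  unfold ev
  rw [Finset.sum_eq_single S]
  · rw [Finset.prod_eq_one, mul_one]
    intro i _
    unfold corner
    split_ifs <;> rfl
  · intro T _ hT
    have : ∃ i, ¬ (i ∈ S ↔ i ∈ T) := by
      by_contra! h
      exact hT (Finset.ext fun i => (h i).symm)
    obtain ⟨i, hi⟩ := this
    rw [Finset.prod_eq_zero (Finset.mem_univ i), mul_zero]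
    unfold corner
    split_ifs <;> first | rfl | tauto
  · simp

theorem corner_update_one_zero (S : Finset (Fin n)) (i : Fin n) :
    update (corner R S) i (1, 0) = corner R (S.erase i) := by
  ext1 k
  by_cases h : k = i
  · subst h; simp [corner]
  · simp [corner, h]

theorem corner_update_zero_one (S : Finset (Fin n)) (i : Fin n) :
    update (corner R S) i (0, 1) = corner R (insert i S) := by
  ext1 k
  by_cases h : k = i
  · subst h; simp [corner]
  · simp [corner, h]

/-- A slotwise linear substitution only changes the coefficient vector: the new coefficients are the
values at the images of the corners. Both the `SL_2` action and the later rotation of slots are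
instances. -/
theorem ev_linear (p q : Fin n → F × F) (s : Fin n → R × R) :
    ev a (fun i => ((s i).1 * algebraMap F R (p i).1 + (s i).2 * algebraMap F R (q i).1,
        (s i).1 * algebraMap F R (p i).2 + (s i).2 * algebraMap F R (q i).2)) =
      ev (fun S => ev a fun i => if i ∈ S then q i else p i) s := by
  unfold ev
  simp only [Algebra.algebraMap_self, RingHom.id_apply, map_sum, map_mul, map_prod,
    Finset.sum_mul]
  rw [Finset.sum_comm]
  refine Finset.sum_congr rfl fun T _ => ?_
  simp only [mul_assoc, ← Finset.mul_sum, ← Finset.prod_mul_distrib]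
  congr 1
  have h : ∀ i, (if i ∈ T then (s i).1 * algebraMap F R (p i).2 + (s i).2 * algebraMap F R (q i).2
      else (s i).1 * algebraMap F R (p i).1 + (s i).2 * algebraMap F R (q i).1) =
      (s i).2 * algebraMap F R (if i ∈ T then (q i).2 else (q i).1) +
      (s i).1 * algebraMap F R (if i ∈ T then (p i).2 else (p i).1) := by
    intro i
    split_ifs <;> ring
  simp only [h]
  rw [Finset.prod_add, Finset.powerset_univ]
  refine Finset.sum_congr rfl fun S _ => ?_
  rw [← Finset.prod_mul_prod_compl S, Finset.compl_eq_univ_sdiff]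
  congr 1 <;> refine Finset.prod_congr rfl fun i hi => ?_
  · simp [hi, mul_comm]
  · have : i ∉ S := by simpa using hi
    simp [this, mul_comm]

end Ev

/-- The generic affine point. -/
def genericPoint (F : Type*) [Field F] (n : ℕ) :
    Fin n → MvPolynomial (Fin n) F × MvPolynomial (Fin n) F :=
  fun i => (X i, 1)

theorem multiaffinePoly_eq_ev (a : Finset (Fin n) → F) :
    multiaffinePoly a = ev a (genericPoint F n) := by
  unfold multiaffinePoly ev genericPoint
  refine Finset.sum_congr rfl fun S _ => ?_
  rw [MvPolynomial.algebraMap_eq, ← Finset.prod_mul_prod_compl S,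
    Finset.prod_eq_one (s := S) fun i hi => if_pos hi, one_mul]
  congr 1
  refine Finset.prod_congr rfl fun i hi => ?_
  have : i ∉ S := by simpa using hi
  simp [this]

theorem prod_X_eq (S : Finset (Fin n)) :
    (∏ i ∈ S, X i : MvPolynomial (Fin n) F) = monomial (∑ i ∈ S, Finsupp.single i 1) 1 := by
  rw [monomial_sum_one]
  rfl

theorem sum_single_apply (S : Finset (Fin n)) (j : Fin n) :
    (∑ i ∈ S, Finsupp.single i (1 : ℕ)) j = if j ∈ S then 1 else 0 := by
  simp [Finsupp.finsetSum_apply, Finsupp.single_apply]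

theorem sum_single_injective :
    Injective fun S : Finset (Fin n) => ∑ i ∈ S, Finsupp.single i (1 : ℕ) := by
  intro S T h
  ext j
  have := DFunLike.congr_fun h j
  simp only [sum_single_apply] at this
  split_ifs at this <;> simp_all

theorem multiaffinePoly_eq_monomial (a : Finset (Fin n) → F) :
    multiaffinePoly a = ∑ S : Finset (Fin n), monomial (∑ i ∈ Sᶜ, Finsupp.single i 1) (a S) := by
  unfold multiaffinePoly
  refine Finset.sum_congr rfl fun S _ => ?_
  rw [prod_X_eq, C_mul_monomial, mul_one]

theorem coeffVec_multiaffinePoly (a : Finset (Fin n) → F) : coeffVec (multiaffinePoly a) = a := by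
  ext S
  unfold coeffVec
  rw [multiaffinePoly_eq_monomial, coeff_sum, Finset.sum_eq_single S]
  · simp
  · intro T _ hT
    rw [coeff_monomial, if_neg]
    intro h
    exact hT (compl_injective (sum_single_injective h))
  · simp

theorem permAct_multiaffinePoly (π : Equiv.Perm (Fin n)) (a : Finset (Fin n) → F) :
    permAct π (multiaffinePoly a) = multiaffinePoly fun S => a (S.map π.symm.toEmbedding) := by
  unfold permAct multiaffinePoly
  simp only [map_sum, map_mul, map_prod, rename_C, rename_X]
  refine Fintype.sum_equiv π.finsetCongr _ _ fun S => ?_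
  congr 1
  · congr 2
    ext i
    simp
  · refine Finset.prod_equiv π (fun i => ?_) (fun _ _ => rfl)
    simp

theorem slAct_multiaffinePoly (γ : Fin n → Matrix.SpecialLinearGroup (Fin 2) F)
    (a : Finset (Fin n) → F) :
    slAct γ (multiaffinePoly a) = multiaffinePoly fun S => ev a fun i =>
      if i ∈ S then ((γ i).1 0 1, (γ i).1 1 1) else ((γ i).1 0 0, (γ i).1 1 0) := by
  have h := ev_linear a (fun i => ((γ i).1 0 0, (γ i).1 1 0)) (fun i => ((γ i).1 0 1, (γ i).1 1 1))
    (genericPoint F n)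
  refine Eq.trans ?_ (h.trans (multiaffinePoly_eq_ev _).symm)
  have hinj : Injective fun S : Finset (Fin n) => ∑ i ∈ Sᶜ, Finsupp.single i (1 : ℕ) :=
    sum_single_injective.comp compl_injective
  have hsub : (multiaffinePoly a).support ⊆
      Finset.univ.image fun S : Finset (Fin n) => ∑ i ∈ Sᶜ, Finsupp.single i (1 : ℕ) := by
    rw [multiaffinePoly_eq_monomial]
    refine (support_sum).trans fun m hm => ?_
    obtain ⟨S, -, hS⟩ := Finset.mem_biUnion.1 hm
    have := support_monomial_subset hS
    exact Finset.mem_image.2 ⟨S, Finset.mem_univ _, (Finset.mem_singleton.1 this).symm⟩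
  unfold slAct
  rw [Finset.sum_subset hsub fun m _ hm => by rw [notMem_support_iff.1 hm, C_0, zero_mul],
    Finset.sum_image hinj.injOn]
  unfold ev
  refine Finset.sum_congr rfl fun S _ => ?_
  have hc : coeff (∑ i ∈ Sᶜ, Finsupp.single i 1) (multiaffinePoly a) = a S :=
    congrFun (coeffVec_multiaffinePoly a) S
  rw [hc]
  refine congrArg₂ _ rfl (Finset.prod_congr rfl fun i _ => ?_)
  by_cases hi : i ∈ S <;> simp [sum_single_apply, hi, genericPoint, mul_comm]

theorem actVec_eq (g : ActingGroup F n) (a : Finset (Fin n) → F) (S : Finset (Fin n)) :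
    actVec g a S = ev a fun i => if g.right i ∈ S
      then ((g.left (g.right i)).1 0 1, (g.left (g.right i)).1 1 1)
      else ((g.left (g.right i)).1 0 0, (g.left (g.right i)).1 1 0) := by
  unfold actVec
  rw [permAct_multiaffinePoly, slAct_multiaffinePoly, coeffVec_multiaffinePoly]
  unfold ev
  refine Fintype.sum_equiv g.right.symm.finsetCongr _ _ fun T => ?_
  congr 1
  refine Fintype.prod_equiv g.right.symm _ _ fun i => ?_
  simp

end

end MultiaffineDet

/-! ### Bordered determinants and Dodgson condensation -/

namespace MultiaffineDet

open MvPolynomial Function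

noncomputable section

section LinearAlgebra

open Matrix

variable {ι : Type*} [Fintype ι] [DecidableEq ι]

/-- The matrix `N` bordered by the column `v`, the row `r` and the entry `d`. -/
def bordered {R : Type*} (N : Matrix ι ι R) (v r : ι → R) (d : R) :
    Matrix (ι ⊕ Unit) (ι ⊕ Unit) R :=
  fromBlocks N (replicateCol Unit v) (replicateRow Unit r) (Matrix.of fun _ _ => d)

variable {R : Type*} [CommRing R]

theorem det_bordered_smul_add (N : Matrix ι ι R) (v r r' : ι → R) (c c' d d' : R) :
    (bordered N v (c • r + c' • r') (c * d + c' * d')).det =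
      c * (bordered N v r d).det + c' * (bordered N v r' d').det := by
  have h : ∀ (r : ι → R) (d : R), bordered N v r d =
      (bordered N v 0 0).updateRow (Sum.inr ()) (Sum.elim r fun _ => d) := by
    intro r d
    ext (i | i) (j | j) <;> simp [bordered, updateRow_apply]
  rw [h, h r, h r', ← det_updateRow_smul, ← det_updateRow_smul, ← det_updateRow_add]
  congr 2
  ext (i | i) <;> simp

theorem det_bordered_zero_one (N : Matrix ι ι R) (v : ι → R) :
    (bordered N v 0 1).det = N.det := by
  have : bordered N v 0 1 = fromBlocks N (replicateCol Unit v) 0 1 := by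
    ext (i | i) (j | j) <;> simp [bordered]
  rw [this, det_fromBlocks_zero₂₁, det_one, mul_one]

theorem det_bordered (N : Matrix ι ι R) (v r : ι → R) (d : R) :
    (bordered N v r d).det = d * N.det + (bordered N v r 0).det := by
  have := det_bordered_smul_add N v r 0 1 d 0 1
  rw [det_bordered_zero_one] at this
  simp only [smul_zero, add_zero, one_smul, mul_zero, zero_add, mul_one, one_mul] at this
  rw [this, add_comm]

/-- The Schur complement of a corner entry `1` turns a bordered determinant into that of a rank-one
update. No invertibility of `N` is needed. -/
theorem det_add_smul_vecMulVec (N : Matrix ι ι R) (v r : ι → R) (c : R) :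
    (N + c • vecMulVec v r).det = N.det - c * (bordered N v r 0).det := by
  have h := det_bordered_smul_add N v r 0 (-c) 1 0 1
  rw [det_bordered_zero_one] at h
  have h2 : bordered N v (-c • r + (1 : R) • 0) (-c * 0 + 1 * 1) =
      fromBlocks N (replicateCol Unit v) (replicateRow Unit (-c • r)) 1 := by
    ext (i | i) (j | j) <;> simp [bordered]
  rw [h2, det_fromBlocks_one₂₂] at h
  have h3 : N - replicateCol Unit v * replicateRow Unit (-c • r) = N + c • vecMulVec v r := by
    ext i j
    simp [Matrix.mul_apply, vecMulVec_apply]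
    ring
  rw [h3] at h
  rw [h]
  ring

omit [DecidableEq ι] in
theorem comp_mulVec {S : Type*} [CommRing S] (φ : R →+* S) (M : Matrix ι ι R) (v : ι → R) :
    φ ∘ (M *ᵥ v) = M.map φ *ᵥ (φ ∘ v) :=
  funext fun i => RingHom.map_mulVec φ M v i

/-- For invertible `N`, `det (N + A B) = det N * det (1 + B N⁻¹ A)` reduces the rank-two update to a
`2 × 2` determinant. Symmetry of `N` makes the two cross terms equal, whence the square. -/
theorem dodgson_field {K : Type*} [Field K] (N : Matrix ι ι K) (hN : N.IsSymm)
    (hdet : N.det ≠ 0) (u v : ι → K) (d : K → K → K)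
    (hd : ∀ x y, d x y = (N + x • vecMulVec u u + y • vecMulVec v v).det) :
    (d 1 0 - d 0 0) * (d 0 1 - d 0 0) - d 0 0 * (d 1 1 - d 1 0 - d 0 1 + d 0 0) =
      (u ⬝ᵥ N.adjugate *ᵥ v) ^ 2 := by
  have hu : IsUnit N.det := hdet.isUnit
  have hsymm : v ⬝ᵥ N⁻¹ *ᵥ u = u ⬝ᵥ N⁻¹ *ᵥ v := by
    rw [dotProduct_comm, dotProduct_mulVec, ← mulVec_transpose, transpose_nonsing_inv, hN.eq]
  have key : ∀ x y, d x y = N.det * ((1 + x * (u ⬝ᵥ N⁻¹ *ᵥ u)) * (1 + y * (v ⬝ᵥ N⁻¹ *ᵥ v)) -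
      x * y * (u ⬝ᵥ N⁻¹ *ᵥ v) ^ 2) := by
    intro x y
    have h1 : N + x • vecMulVec u u + y • vecMulVec v v =
        N + (Matrix.of ![u, v])ᵀ * Matrix.of ![x • u, y • v] := by
      ext i j
      simp [Matrix.mul_apply, Fin.sum_univ_two, vecMulVec_apply]
      ring
    have h2 : Matrix.of ![x • u, y • v] * N⁻¹ * (Matrix.of ![u, v])ᵀ =
        !![x * (u ⬝ᵥ N⁻¹ *ᵥ u), x * (u ⬝ᵥ N⁻¹ *ᵥ v); y * (v ⬝ᵥ N⁻¹ *ᵥ u),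
          y * (v ⬝ᵥ N⁻¹ *ᵥ v)] := by
      rw [Matrix.mul_assoc]
      ext i j
      fin_cases i <;> fin_cases j <;>
        simp [Matrix.mul_apply, dotProduct, mulVec, Finset.mul_sum, mul_assoc]
    rw [hd, h1, det_add_mul _ _ hu, h2, det_fin_two, hsymm]
    simp only [Matrix.add_apply, Matrix.one_apply, of_apply, cons_val', cons_val_zero, cons_val_one,
      cons_val_fin_one, if_true, zero_ne_one, one_ne_zero, if_false]
    ring
  have hadj : N.adjugate = N.det • N⁻¹ := by
    rw [inv_def, smul_smul, Ring.mul_inverse_cancel _ hu, one_smul]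
  rw [key, key, key, key, hadj, smul_mulVec, dotProduct_smul]
  simp only [smul_eq_mul]
  ring

/-- `N + X` has monic determinant in `R[X]`, being the characteristic matrix of `-N`, so it is
invertible over the fraction field. The identity holds there, descends to `R[X]`, and is specialised
at `X = 0`. -/
theorem dodgson [IsDomain R] (N : Matrix ι ι R) (hN : N.IsSymm)
    (u v : ι → R) (d : R → R → R)
    (hd : ∀ x y, d x y = (N + x • vecMulVec u u + y • vecMulVec v v).det) :
    (d 1 0 - d 0 0) * (d 0 1 - d 0 0) - d 0 0 * (d 1 1 - d 1 0 - d 0 1 + d 0 0) =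
      (u ⬝ᵥ N.adjugate *ᵥ v) ^ 2 := by
  classical
  let T : Matrix ι ι (Polynomial R) := N.map Polynomial.C + Matrix.scalar ι Polynomial.X
  let U : ι → Polynomial R := fun i => Polynomial.C (u i)
  let V : ι → Polynomial R := fun i => Polynomial.C (v i)
  let d' : Polynomial R → Polynomial R → Polynomial R := fun x y =>
    (T + x • vecMulVec U U + y • vecMulVec V V).det
  have hT : T.det ≠ 0 := by
    have : T = charmatrix (-N) := by
      ext1 i j
      simp [T, charmatrix, add_comm]
    rw [this]
    exact (charpoly_monic (-N)).ne_zero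
  have hTs : T.IsSymm := by
    have h1 : (N.map Polynomial.C).IsSymm := hN.map _
    exact h1.add (isSymm_diagonal _)
  let K := FractionRing (Polynomial R)
  let φ : Polynomial R →+* K := algebraMap _ _
  have hφ : Injective φ := IsFractionRing.injective _ _
  have hpoly : (d' 1 0 - d' 0 0) * (d' 0 1 - d' 0 0) -
      d' 0 0 * (d' 1 1 - d' 1 0 - d' 0 1 + d' 0 0) = (U ⬝ᵥ T.adjugate *ᵥ V) ^ 2 := by
    apply hφ
    have hdK : ∀ x y, φ (d' x y) = (T.map φ + φ x • vecMulVec (φ ∘ U) (φ ∘ U) +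
        φ y • vecMulVec (φ ∘ V) (φ ∘ V)).det := by
      intro x y
      rw [RingHom.map_det]
      congr 1
      ext i j
      simp [vecMulVec_apply]
    have := dodgson_field (T.map φ) (hTs.map _) (by
      rw [← RingHom.mapMatrix_apply, ← RingHom.map_det]
      exact (map_ne_zero_iff φ hφ).2 hT) (φ ∘ U) (φ ∘ V) _ (fun x y => rfl)
    simp only [map_sub, map_mul, map_add, map_pow, hdK, map_one, map_zero]
    rw [this, RingHom.map_dotProduct, comp_mulVec]
    congr 3
    rw [← RingHom.mapMatrix_apply, ← RingHom.map_adjugate]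
    rfl
  let ψ : Polynomial R →+* R := Polynomial.evalRingHom 0
  have hTψ : T.map ψ = N := by
    ext i j
    by_cases h : i = j <;> simp [T, ψ, h]
  have hψ : ∀ x y, ψ (d' x y) = d (ψ x) (ψ y) := by
    intro x y
    rw [hd, RingHom.map_det]
    congr 1
    rw [← hTψ]
    ext i j
    simp [vecMulVec_apply, U, V, ψ]
  have := congrArg ψ hpoly
  simp only [map_sub, map_mul, map_add, map_pow, hψ, map_one, map_zero] at this
  rw [this, RingHom.map_dotProduct, comp_mulVec]
  congr 2
  · ext i; simp [U, ψ]
  · congr 1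
    · rw [← hTψ]
      exact RingHom.map_adjugate ψ T
    · ext i; simp [V, ψ]

end LinearAlgebra

end

end MultiaffineDet

/-! ### Rayleigh differences, hyperdeterminants, and condition (ii) without the group -/

namespace MultiaffineDet

open MvPolynomial Function

noncomputable section

universe u

variable {F : Type u} [Field F] {n : ℕ}

section Slots

variable {R : Type*} [CommRing R] [Algebra F R] (a : Finset (Fin n) → F)

/-- The value of the multihomogenization with three slots replaced. -/
def slot3 (i j k : Fin n) (P : Fin n → R × R) (x y z : R × R) : R :=
  ev a (update (update (update P i x) j y) k z)

/-- The Rayleigh difference `∂_i f ∂_j f - f ∂_i ∂_j f` at a point of the multihomogenization. -/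
def rayleigh (i j : Fin n) (P : Fin n → R × R) : R :=
  ev a (update (update P i (1, 0)) j (0, 1)) * ev a (update (update P i (0, 1)) j (1, 0)) -
    ev a (update (update P i (1, 0)) j (1, 0)) * ev a (update (update P i (0, 1)) j (0, 1))

/-- Cayley's hyperdeterminant as a function of its eight arguments. -/
def cayley (t₀ t₁ t₂ t₃ t₁₂ t₁₃ t₂₃ t₁₂₃ : R) : R :=
  t₀ ^ 2 * t₁₂₃ ^ 2 + t₁ ^ 2 * t₂₃ ^ 2 + t₂ ^ 2 * t₁₃ ^ 2 + t₃ ^ 2 * t₁₂ ^ 2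
    - 2 * t₀ * t₁ * t₂₃ * t₁₂₃ - 2 * t₀ * t₂ * t₁₃ * t₁₂₃ - 2 * t₀ * t₃ * t₁₂ * t₁₂₃
    - 2 * t₁ * t₂ * t₁₃ * t₂₃ - 2 * t₁ * t₃ * t₁₂ * t₂₃ - 2 * t₂ * t₃ * t₁₂ * t₁₃
    + 4 * t₀ * t₂₃ * t₁₃ * t₁₂ + 4 * t₁₂₃ * t₁ * t₂ * t₃

/-- The hyperdeterminant of the `2 × 2 × 2` tensor `slot3`, with respect to bases of the slots. -/
def hyperdetAt (i j k : Fin n) (P : Fin n → R × R) (x₀ x₁ y₀ y₁ z₀ z₁ : R × R) : R :=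
  cayley (slot3 a i j k P x₀ y₀ z₀) (slot3 a i j k P x₁ y₀ z₀) (slot3 a i j k P x₀ y₁ z₀)
    (slot3 a i j k P x₀ y₀ z₁) (slot3 a i j k P x₁ y₁ z₀) (slot3 a i j k P x₁ y₀ z₁)
    (slot3 a i j k P x₀ y₁ z₁) (slot3 a i j k P x₁ y₁ z₁)

/-- The hyperdeterminant with respect to the standard bases. -/
def hyperdet (i j k : Fin n) (P : Fin n → R × R) : R :=
  hyperdetAt a i j k P (1, 0) (0, 1) (1, 0) (0, 1) (1, 0) (0, 1)

variable {i j k : Fin n} (P : Fin n → R × R)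

theorem slot3_algebraMap (P : Fin n → F × F) (x y z : F × F) :
    algebraMap F R (slot3 a i j k P x y z) =
      slot3 a i j k (fun l => (algebraMap F R (P l).1, algebraMap F R (P l).2))
        (algebraMap F R x.1, algebraMap F R x.2) (algebraMap F R y.1, algebraMap F R y.2)
        (algebraMap F R z.1, algebraMap F R z.2) := by
  refine (ev_map a (Algebra.ofId F R) (update (update (update P i x) j y) k z)).trans ?_
  unfold slot3
  congr 1
  funext l
  simp only [update_apply]
  split_ifs <;> rfl

theorem slot3_update_of_mem (l : Fin n) (hl : l = i ∨ l = j ∨ l = k) (w x y z : R × R) :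
    slot3 a i j k (update P l w) x y z = slot3 a i j k P x y z := by
  unfold slot3
  congr 1
  funext m
  simp only [update_apply]
  split_ifs <;> grind

theorem slot3_update {l : Fin n} (hi : l ≠ i) (hj : l ≠ j) (hk : l ≠ k) (p q : R)
    (x y z : R × R) : slot3 a i j k (update P l (p, q)) x y z =
      p * slot3 a i j k (update P l (1, 0)) x y z + q * slot3 a i j k (update P l (0, 1)) x y z := by
  unfold slot3
  simp only [update_comm hi, update_comm hj, update_comm hk]
  exact ev_update a _ l p q

theorem slot3_fst (hij : i ≠ j) (hik : i ≠ k) (p q : R) (y z : R × R) :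
    slot3 a i j k P (p, q) y z =
      p * slot3 a i j k P (1, 0) y z + q * slot3 a i j k P (0, 1) y z := by
  unfold slot3
  simp only [update_comm hij, update_comm hik]
  exact ev_update a _ i p q

theorem slot3_snd (hjk : j ≠ k) (p q : R) (x z : R × R) :
    slot3 a i j k P x (p, q) z =
      p * slot3 a i j k P x (1, 0) z + q * slot3 a i j k P x (0, 1) z := by
  unfold slot3
  simp only [update_comm hjk]
  exact ev_update a _ j p q

theorem slot3_thd (p q : R) (x y : R × R) :
    slot3 a i j k P x y (p, q) =
      p * slot3 a i j k P x y (1, 0) + q * slot3 a i j k P x y (0, 1) :=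
  ev_update a _ k p q

/-- A change of basis in one slot multiplies the hyperdeterminant by the square of its determinant.
-/
theorem hyperdetAt_eq (hij : i ≠ j) (hik : i ≠ k) (hjk : j ≠ k)
    (α β γ δ α' β' γ' δ' α'' β'' γ'' δ'' : R) (h : α * δ - β * γ = 1) (h' : α' * δ' - β' * γ' = 1)
    (h'' : α'' * δ'' - β'' * γ'' = 1) :
    hyperdetAt a i j k P (α, γ) (β, δ) (α', γ') (β', δ') (α'', γ'') (β'', δ'') =
      hyperdet a i j k P := by
  have h1 : ∀ y₀ y₁ z₀ z₁, hyperdetAt a i j k P (α, γ) (β, δ) y₀ y₁ z₀ z₁ =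
      (α * δ - β * γ) ^ 2 * hyperdetAt a i j k P (1, 0) (0, 1) y₀ y₁ z₀ z₁ := by
    intro y₀ y₁ z₀ z₁
    simp only [hyperdetAt, slot3_fst a P hij hik α, slot3_fst a P hij hik β, cayley]
    ring
  have h2 : ∀ x₀ x₁ z₀ z₁, hyperdetAt a i j k P x₀ x₁ (α', γ') (β', δ') z₀ z₁ =
      (α' * δ' - β' * γ') ^ 2 * hyperdetAt a i j k P x₀ x₁ (1, 0) (0, 1) z₀ z₁ := by
    intro x₀ x₁ z₀ z₁
    simp only [hyperdetAt, slot3_snd a P hjk α', slot3_snd a P hjk β', cayley]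
    ring
  have h3 : ∀ x₀ x₁ y₀ y₁, hyperdetAt a i j k P x₀ x₁ y₀ y₁ (α'', γ'') (β'', δ'') =
      (α'' * δ'' - β'' * γ'') ^ 2 * hyperdetAt a i j k P x₀ x₁ y₀ y₁ (1, 0) (0, 1) := by
    intro x₀ x₁ y₀ y₁
    simp only [hyperdetAt, slot3_thd a P α'', slot3_thd a P β'', cayley]
    ring
  rw [h1, h2, h3, h, h', h'', hyperdet]
  ring

/-- The middle coefficient of a Rayleigh difference as a quadratic form in the slot `k`. -/
def rayleighMid (i j k : Fin n) (P : Fin n → R × R) : R :=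
  slot3 a i j k P (1, 0) (0, 1) (1, 0) * slot3 a i j k P (0, 1) (1, 0) (0, 1) +
    slot3 a i j k P (1, 0) (0, 1) (0, 1) * slot3 a i j k P (0, 1) (1, 0) (1, 0) -
    slot3 a i j k P (1, 0) (1, 0) (1, 0) * slot3 a i j k P (0, 1) (0, 1) (0, 1) -
    slot3 a i j k P (1, 0) (1, 0) (0, 1) * slot3 a i j k P (0, 1) (0, 1) (1, 0)

theorem rayleigh_update_eq_slot3 (hik : i ≠ k) (hjk : j ≠ k) (z : R × R) :
    rayleigh a i j (update P k z) =
      slot3 a i j k P (1, 0) (0, 1) z * slot3 a i j k P (0, 1) (1, 0) z -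
        slot3 a i j k P (1, 0) (1, 0) z * slot3 a i j k P (0, 1) (0, 1) z := by
  simp only [rayleigh, slot3, update_comm hik.symm, update_comm hjk.symm]

theorem rayleigh_update (hik : i ≠ k) (hjk : j ≠ k) (x y : R) :
    rayleigh a i j (update P k (x, y)) =
      rayleigh a i j (update P k (1, 0)) * x ^ 2 + rayleighMid a i j k P * (x * y) +
        rayleigh a i j (update P k (0, 1)) * y ^ 2 := by
  simp only [rayleigh_update_eq_slot3 a P hik hjk, slot3_thd a P x y, rayleighMid]
  ring

/-- The Rayleigh difference is minus the determinant of the `2 × 2` slice of the tensor in direction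
`k`, and the hyperdeterminant is the discriminant of that binary quadratic form. -/
theorem hyperdet_eq_discrim (hik : i ≠ k) (hjk : j ≠ k) :
    hyperdet a i j k P = rayleighMid a i j k P ^ 2 -
      4 * rayleigh a i j (update P k (1, 0)) * rayleigh a i j (update P k (0, 1)) := by
  simp only [rayleigh_update_eq_slot3 a P hik hjk, rayleighMid, hyperdet, hyperdetAt, cayley]
  ring

theorem rayleigh_congr (i j : Fin n) {P Q : Fin n → R × R}
    (h : ∀ l, l ≠ i → l ≠ j → P l = Q l) : rayleigh a i j P = rayleigh a i j Q := by
  have : ∀ z w, update (update P i z) j w = update (update Q i z) j w := by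
    intro z w
    funext l
    simp only [update_apply]
    split_ifs <;> grind
  simp only [rayleigh, this]

theorem rayleigh_corner {i j : Fin n} (hij : i ≠ j) {S : Finset (Fin n)} (hi : i ∉ S)
    (hj : j ∉ S) : rayleigh a i j (corner R S) = algebraMap F R
      (a (insert i S) * a (insert j S) - a S * a (insert i (insert j S))) := by
  have hj' : j ∉ insert i S := by simp [hj, hij.symm]
  simp only [rayleigh, corner_update_one_zero, corner_update_zero_one, ev_corner]
  rw [Finset.erase_eq_of_notMem hi, Finset.erase_eq_of_notMem hj,
    Finset.erase_eq_of_notMem hj', Finset.insert_comm]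
  simp only [map_sub, map_mul]
  ring

end Slots

/-- For subsets of the first three indices, every other slot sees only the first column of its
matrix. The three distinguished slots undergo a unimodular base change, which does not matter. -/
theorem hypDet_actVec (h : 3 ≤ n) (g : ActingGroup F n) (a : Finset (Fin n) → F) :
    hypDet h (actVec g a) = hyperdet a (g.right.symm ⟨0, by omega⟩) (g.right.symm ⟨1, by omega⟩)
      (g.right.symm ⟨2, by omega⟩)
      fun i => ((g.left (g.right i)).1 0 0, (g.left (g.right i)).1 1 0) := by
  have hdet : ∀ l, (g.left l).1 0 0 * (g.left l).1 1 1 - (g.left l).1 0 1 * (g.left l).1 1 0 = 1 :=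
    fun l => by rw [← Matrix.det_fin_two]; exact (g.left l).2
  have h01 : (⟨0, by omega⟩ : Fin n) ≠ ⟨1, by omega⟩ := by simp
  have h02 : (⟨0, by omega⟩ : Fin n) ≠ ⟨2, by omega⟩ := by simp
  have h12 : (⟨1, by omega⟩ : Fin n) ≠ ⟨2, by omega⟩ := by simp
  rw [← hyperdetAt_eq a _ (g.right.symm.injective.ne h01) (g.right.symm.injective.ne h02)
    (g.right.symm.injective.ne h12) _ _ _ _ _ _ _ _ _ _ _ _ (hdet ⟨0, by omega⟩)
    (hdet ⟨1, by omega⟩) (hdet ⟨2, by omega⟩)]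
  unfold hypDet
  dsimp only
  generalize (⟨0, by omega⟩ : Fin n) = i at *
  generalize (⟨1, by omega⟩ : Fin n) = j at *
  generalize (⟨2, by omega⟩ : Fin n) = k at *
  have key : ∀ S : Finset (Fin n), S ⊆ {i, j, k} → actVec g a S =
      slot3 a (g.right.symm i) (g.right.symm j) (g.right.symm k)
        (fun i => ((g.left (g.right i)).1 0 0, (g.left (g.right i)).1 1 0))
        (if i ∈ S then ((g.left i).1 0 1, (g.left i).1 1 1)
          else ((g.left i).1 0 0, (g.left i).1 1 0))
        (if j ∈ S then ((g.left j).1 0 1, (g.left j).1 1 1)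
          else ((g.left j).1 0 0, (g.left j).1 1 0))
        (if k ∈ S then ((g.left k).1 0 1, (g.left k).1 1 1)
          else ((g.left k).1 0 0, (g.left k).1 1 0)) := by
    intro S hS
    rw [actVec_eq, slot3]
    congr 1
    funext l
    simp only [update_apply, Equiv.eq_symm_apply]
    by_cases hk : g.right l = k
    · rw [if_pos hk, hk]
    by_cases hj : g.right l = j
    · rw [if_neg hk, if_pos hj, hj]
    by_cases hi : g.right l = i
    · rw [if_neg hk, if_neg hj, if_pos hi, hi]
    · rw [if_neg hk, if_neg hj, if_neg hi, if_neg]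
      intro hl
      simpa [hi, hj, hk] using hS hl
  have hi : ({i} : Finset (Fin n)) ⊆ {i, j, k} := by simp
  have hj : ({j} : Finset (Fin n)) ⊆ {i, j, k} := by simp
  have hk : ({k} : Finset (Fin n)) ⊆ {i, j, k} := by simp
  have hij : ({i, j} : Finset (Fin n)) ⊆ {i, j, k} := by grind
  have hik : ({i, k} : Finset (Fin n)) ⊆ {i, j, k} := by grind
  have hjk : ({j, k} : Finset (Fin n)) ⊆ {i, j, k} := by grind
  rw [key ∅ (by simp), key {i} hi, key {j} hj, key {k} hk, key {i, j} hij, key {i, k} hik,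
    key {j, k} hjk, key {i, j, k} (by simp)]
  simp only [Finset.mem_insert, Finset.mem_singleton, Finset.notMem_empty, h01, h02, h12,
    h01.symm, h02.symm, h12.symm, or_true, or_false, if_true, if_false, hyperdetAt,
    cayley]

theorem exists_specialLinear_col (p : F × F) (hp : p ≠ 0) :
    ∃ γ : Matrix.SpecialLinearGroup (Fin 2) F, (γ.1 0 0, γ.1 1 0) = p := by
  obtain ⟨s, t⟩ := p
  by_cases hs : s = 0
  · have ht : t ≠ 0 := fun ht => hp (by simp [hs, ht])
    exact ⟨⟨!![s, -t⁻¹; t, 0], by simp [Matrix.det_fin_two, ht]⟩, by simp⟩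
  · exact ⟨⟨!![s, 0; t, s⁻¹], by simp [Matrix.det_fin_two, hs]⟩, by simp⟩

theorem ev_eq_zero_of_slot_eq_zero {R : Type*} [CommRing R] [Algebra F R]
    (a : Finset (Fin n) → F) (P : Fin n → R × R) (l : Fin n) (h : P l = 0) : ev a P = 0 := by
  unfold ev
  refine Finset.sum_eq_zero fun S _ => ?_
  rw [Finset.prod_eq_zero (Finset.mem_univ l), mul_zero]
  simp [h]

/-- The permutation moves the first three indices to any triple, and any nonzero vector is the first
column of a matrix in `SL_2`. A zero vector in one of the other slots makes the whole tensor vanish.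
-/
theorem hypDetCondition_iff (a : Finset (Fin n) → F) :
    HypDetCondition a ↔ ∀ i j k : Fin n, i ≠ j → i ≠ k → j ≠ k → ∀ P : Fin n → F × F,
      hyperdet a i j k P = 0 := by
  constructor
  · intro H i j k hij hik hjk P
    by_cases hP : ∀ l, l ≠ i → l ≠ j → l ≠ k → P l ≠ 0
    · have h3 : 3 ≤ n := by
        have := Finset.card_le_univ ({i, j, k} : Finset (Fin n))
        rwa [Finset.card_eq_three.2 ⟨i, j, k, hij, hik, hjk, rfl⟩, Fintype.card_fin] at this
      let z : Fin n := ⟨0, by omega⟩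
      let o : Fin n := ⟨1, by omega⟩
      let w : Fin n := ⟨2, by omega⟩
      have hzo : z ≠ o := by simp [z, o]
      have hzw : z ≠ w := by simp [z, w]
      have how : o ≠ w := by simp [o, w]
      obtain ⟨π, hπ⟩ : ∃ π : Equiv.Perm (Fin n), π z = i ∧ π o = j ∧ π w = k := by
        obtain ⟨e, he⟩ := Equiv.Perm.exists_extending_pair ![z, o, w] ![i, j, k]
          (by
            intro x y
            fin_cases x <;> fin_cases y <;> simp [hzo, hzw, how, hzo.symm, hzw.symm, how.symm])
          (by
            intro x y
            fin_cases x <;> fin_cases y <;> simp [hij, hik, hjk, hij.symm, hik.symm, hjk.symm])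
        exact ⟨e, he 0, he 1, he 2⟩
      obtain ⟨hi, hj, hk⟩ := hπ
      -- The tensor ignores the slots `i, j, k` of the point, so they may be reset to nonzero
      -- vectors.
      let Q : Fin n → F × F := update (update (update P i (1, 0)) j (1, 0)) k (1, 0)
      have hQ : ∀ l, Q l ≠ 0 := by
        intro l
        simp only [Q, update_apply]
        split_ifs with h1 h2 h3
        · simp
        · simp
        · simp
        · exact hP l h3 h2 h1
      choose γ hγ using fun l => exists_specialLinear_col (Q l) (hQ l)
      -- `hypDet_actVec` uses the inverse of the permutation and twists the matrices by it; `π.symm`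
      -- and the reindexing by `π` cancel both.
      have := H h3 ⟨fun l => γ (π l), π.symm⟩
      rw [actFun, hypDet_actVec] at this
      simp only [Equiv.symm_symm, Equiv.apply_symm_apply, hγ] at this
      have e : hyperdet a (π z) (π o) (π w) Q = 0 := this
      rw [hi, hj, hk] at e
      rw [← e]
      have : ∀ x y v, slot3 a i j k P x y v = slot3 a i j k Q x y v := by
        intro x y v
        unfold slot3
        congr 1
        funext l
        simp only [Q, update_apply]
        split_ifs <;> rfl
      simp only [hyperdet, hyperdetAt, this]
    · push Not at hP
      obtain ⟨l, hi, hj, hk, hl⟩ := hP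
      have : ∀ x y z, slot3 a i j k P x y z = 0 := by
        intro x y z
        refine ev_eq_zero_of_slot_eq_zero a _ l ?_
        rw [update_of_ne hk, update_of_ne hj, update_of_ne hi, hl]
      simp [hyperdet, hyperdetAt, this, cayley]
  · intro H h g
    rw [actFun, hypDet_actVec]
    refine H _ _ _ ?_ ?_ ?_ _ <;> simp

end

end MultiaffineDet

/-! ### Necessity: pencils under projective substitutions -/

namespace MultiaffineDet

open MvPolynomial Function

noncomputable section

universe u

variable {F : Type u} [Field F] {n : ℕ}

/-- The linear pencil `∑ x_i v_i v_iᵀ + W`. -/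
def pencil {ι : Type*} {R : Type*} [CommRing R] [Algebra F R] (v : Fin n → ι → F)
    (W : Matrix ι ι F) (x : Fin n → R) : Matrix ι ι R :=
  ∑ i, x i • (Matrix.vecMulVec (v i) (v i)).map (algebraMap F R) + W.map (algebraMap F R)

/-- The point with slots `(x_i, 1)` on `V` and slots `(s_i, t_i - s_i κ_i ^ 2 x_i)` elsewhere. -/
def mixedPoint {R : Type*} [CommRing R] [Algebra F R] (V : Finset (Fin n)) (s t κ : Fin n → F)
    (x : Fin n → R) : Fin n → R × R :=
  fun i => if i ∈ V then (x i, 1) else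
    (algebraMap F R (s i), algebraMap F R (t i) - algebraMap F R (s i * κ i ^ 2) * x i)

/-- The multihomogenization of `f_a` is, along `mixedPoint`, the determinant of a pencil. -/
def HasPencil (a : Finset (Fin n) → F) (V : Finset (Fin n)) (s t κ : Fin n → F) : Prop :=
  ∃ (ι : Type) (_ : Fintype ι) (_ : DecidableEq ι) (lam : F) (v : Fin n → ι → F)
    (W : Matrix ι ι F), W.IsSymm ∧ ∀ (R : Type u) [CommRing R] [Algebra F R] (x : Fin n → R),
      ev a (mixedPoint V s t κ x) = algebraMap F R lam * (pencil v W x).det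

section Pencil

variable {ι : Type*} {R : Type*} [CommRing R] [Algebra F R]

theorem pencil_apply (v : Fin n → ι → F) (W : Matrix ι ι F) (x : Fin n → R) (p q : ι) :
    pencil v W x p q = ∑ i, x i * (algebraMap F R (v i p) * algebraMap F R (v i q)) +
      algebraMap F R (W p q) := by
  simp [pencil, Matrix.sum_apply, Matrix.vecMulVec_apply]

theorem pencil_isSymm (v : Fin n → ι → F) (W : Matrix ι ι F) (hW : W.IsSymm) (x : Fin n → R) :
    (pencil v W x).IsSymm := by
  ext p q
  rw [Matrix.transpose_apply, pencil_apply, pencil_apply, hW.apply]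
  simp only [mul_comm (algebraMap F R (v _ q))]

theorem pencil_update (v : Fin n → ι → F) (W : Matrix ι ι F) (x : Fin n → R) (l : Fin n) (z : R) :
    pencil v W (update x l z) = pencil v W (update x l 0) +
      z • Matrix.vecMulVec (algebraMap F R ∘ v l) (algebraMap F R ∘ v l) := by
  ext p q
  have h : ∀ z : R, ∑ i, update x l z i * (algebraMap F R (v i p) * algebraMap F R (v i q)) =
      z * (algebraMap F R (v l p) * algebraMap F R (v l q)) +
        ∑ i ∈ Finset.univ.erase l, x i * (algebraMap F R (v i p) * algebraMap F R (v i q)) := by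
    intro z
    rw [← Finset.add_sum_erase _ _ (Finset.mem_univ l), update_self]
    congr 1
    refine Finset.sum_congr rfl fun i hi => ?_
    rw [update_of_ne (Finset.ne_of_mem_erase hi)]
  simp only [Matrix.add_apply, pencil_apply, h, Matrix.smul_apply, Matrix.vecMulVec_apply,
    comp_apply, smul_eq_mul]
  ring

theorem pencil_map {R' : Type*} [CommRing R'] [Algebra F R'] (φ : R →ₐ[F] R')
    (v : Fin n → ι → F) (W : Matrix ι ι F) (x : Fin n → R) :
    (pencil v W x).map φ = pencil v W (φ ∘ x) := by
  ext p q
  simp [pencil_apply]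

end Pencil

theorem multiaffinePoly_isDeterminantal_iff (f : MvPolynomial (Fin n) F) :
    IsDeterminantal f ↔ ∃ (ι : Type) (_ : Fintype ι) (_ : DecidableEq ι) (lam : F)
      (v : Fin n → ι → F) (W : Matrix ι ι F), W.IsSymm ∧ f = C lam * (pencil v W X).det := by
  constructor
  · rintro ⟨m, lam, v, W, hW, h⟩
    exact ⟨Fin m, inferInstance, inferInstance, lam, v, W, hW, h⟩
  · rintro ⟨ι, _, _, lam, v, W, hW, h⟩
    let e := Fintype.equivFin ι
    refine ⟨Fintype.card ι, lam, fun i => v i ∘ e.symm, W.submatrix e.symm e.symm,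
      hW.submatrix _, ?_⟩
    rw [h, ← Matrix.det_submatrix_equiv_self e.symm]
    congr 2
    ext1 p q
    rw [Matrix.submatrix_apply, pencil_apply]
    simp [Matrix.sum_apply, Matrix.vecMulVec_apply, MvPolynomial.algebraMap_eq]

theorem IsDeterminantal.hasPencil {a : Finset (Fin n) → F}
    (h : IsDeterminantal (multiaffinePoly a)) (s t κ : Fin n → F) :
    HasPencil a Finset.univ s t κ := by
  obtain ⟨ι, h1, h2, lam, v, W, hW, h⟩ := (multiaffinePoly_isDeterminantal_iff _).1 h
  refine ⟨ι, h1, h2, lam, v, W, hW, fun R _ _ x => ?_⟩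
  have := congrArg (aeval x) h
  rw [multiaffinePoly_eq_ev, ev_map, map_mul, AlgHom.map_det, AlgHom.mapMatrix_apply,
    pencil_map] at this
  have e : (⇑(aeval x : MvPolynomial (Fin n) F →ₐ[F] R) ∘ X) = x := funext fun i => aeval_X x i
  rw [e] at this
  have e' : mixedPoint Finset.univ s t κ x = fun i => (x i, 1) := by
    funext i
    simp [mixedPoint]
  rw [e']
  simpa [genericPoint] using this

/-- Write `N` for the pencil with `x_l = 0`. In slot `l` the form is linear, with coefficients `λ
det N` and `-λ` times the determinant of `N` bordered by `v_l` with corner `0`. If `s_l = 0`, only a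
multiple of `det N` survives and `v_l` is dropped. Otherwise bordering with corner `κ_l² x_l - t_l /
s_l` and scalar `-λ s_l` gives the required combination; the new vector for `x_l` is `κ_l` times the
new basis vector. Only `κ = 0` (frozen slot) and `κ = 1` (rotation) are used. -/
theorem HasPencil.erase {a : Finset (Fin n) → F} {V : Finset (Fin n)} {s t κ : Fin n → F}
    (h : HasPencil a V s t κ) (l : Fin n) (hl : l ∈ V) : HasPencil a (V.erase l) s t κ := by
  classical
  obtain ⟨ι, h1, h2, lam, v, W, hW, h⟩ := h
  have key : ∀ (R : Type u) [CommRing R] [Algebra F R] (x : Fin n → R),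
      ev a (mixedPoint (V.erase l) s t κ x) = algebraMap F R lam *
        ((algebraMap F R (t l) - algebraMap F R (s l * κ l ^ 2) * x l) *
            (pencil v W (update x l 0)).det -
          algebraMap F R (s l) * (bordered (pencil v W (update x l 0)) (algebraMap F R ∘ v l)
            (algebraMap F R ∘ v l) 0).det) := by
    intro R _ _ x
    have hz : ∀ z : R, mixedPoint V s t κ (update x l z) =
        update (mixedPoint (V.erase l) s t κ x) l (z, 1) := by
      intro z
      funext i
      by_cases hi : i = l
      · subst hi; simp [mixedPoint, hl]
      · simp [mixedPoint, hi]
    have hP : mixedPoint (V.erase l) s t κ x = update (mixedPoint (V.erase l) s t κ x) l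
        (algebraMap F R (s l), algebraMap F R (t l) - algebraMap F R (s l * κ l ^ 2) * x l) := by
      funext i
      by_cases hi : i = l
      · subst hi; simp [mixedPoint]
      · simp [hi]
    have e0 := h R (update x l 0)
    have e1 := h R (update x l 1)
    rw [hz, ev_update] at e0 e1
    rw [pencil_update, det_add_smul_vecMulVec] at e1
    rw [hP, ev_update]
    generalize ev a (update (mixedPoint (V.erase l) s t κ x) l (1, 0)) = A at *
    generalize ev a (update (mixedPoint (V.erase l) s t κ x) l (0, 1)) = B at *
    linear_combination (algebraMap F R (t l) - algebraMap F R (s l * κ l ^ 2) * x l -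
      algebraMap F R (s l)) * e0 + algebraMap F R (s l) * e1
  by_cases hs : s l = 0
  · refine ⟨ι, h1, h2, lam * t l, update v l 0, W, hW, fun R _ _ x => ?_⟩
    rw [key, hs]
    have : pencil (update v l 0) W x = pencil v W (update x l 0) := by
      ext p q
      rw [pencil_apply, pencil_apply]
      congr 1
      refine Finset.sum_congr rfl fun i _ => ?_
      by_cases hi : i = l
      · subst hi; simp
      · simp [hi]
    rw [this]
    simp
    ring
  · refine ⟨ι ⊕ Unit, inferInstance, inferInstance, -(lam * s l),
      update (fun i => Sum.elim (v i) 0) l (Sum.elim 0 fun _ => κ l),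
      bordered W (v l) (v l) (-(t l / s l)), ?_, fun R _ _ x => ?_⟩
    · ext (p | p) (q | q) <;> simp [bordered, hW.apply]
    · have : pencil (update (fun i => Sum.elim (v i) 0) l (Sum.elim 0 fun _ => κ l))
          (bordered W (v l) (v l) (-(t l / s l))) x = bordered (pencil v W (update x l 0))
            (algebraMap F R ∘ v l) (algebraMap F R ∘ v l)
            (algebraMap F R (κ l ^ 2) * x l - algebraMap F R (t l / s l)) := by
        ext (p | p) (q | q) <;> simp only [pencil_apply, bordered, Matrix.fromBlocks_apply₁₁,
          Matrix.fromBlocks_apply₁₂, Matrix.fromBlocks_apply₂₁, Matrix.fromBlocks_apply₂₂]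
        · congr 1
          refine Finset.sum_congr rfl fun i _ => ?_
          by_cases hi : i = l
          · subst hi; simp
          · simp [hi]
        · rw [Finset.sum_eq_zero]
          · simp
          · intro i _
            by_cases hi : i = l
            · subst hi; simp
            · simp [hi]
        · rw [Finset.sum_eq_zero]
          · simp
          · intro i _
            by_cases hi : i = l
            · subst hi; simp
            · simp [hi]
        · rw [Finset.sum_eq_single l]
          · simp
            ring
          · intro i _ hi
            simp [hi]
          · simp
      rw [key, this, det_bordered _ _ _ (_ - _)]
      have ht : algebraMap F R (t l) = algebraMap F R (s l) * algebraMap F R (t l / s l) := by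
        rw [← map_mul, mul_div_cancel₀ _ hs]
      rw [ht]
      generalize algebraMap F R (t l / s l) = c
      simp only [map_mul, map_neg, map_pow]
      ring

theorem HasPencil.mono {a : Finset (Fin n) → F} {V : Finset (Fin n)} {s t κ : Fin n → F}
    (h : HasPencil a V s t κ) (U : Finset (Fin n)) (hU : U ⊆ V) : HasPencil a U s t κ := by
  induction V using Finset.strongInduction with
  | H V ih =>
    by_cases hUV : U = V
    · exact hUV ▸ h
    · obtain ⟨l, hl, hlU⟩ := Finset.exists_of_ssubset (hU.ssubset_of_ne hUV)
      exact ih (V.erase l) (Finset.erase_ssubset hl) (h.erase l hl)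
        fun i hi => Finset.mem_erase.2 ⟨fun e => hlU (e ▸ hi), hU hi⟩

theorem HasPencil.isSquare_rayleigh {a : Finset (Fin n) → F} {V : Finset (Fin n)}
    {s t κ : Fin n → F} (h : HasPencil a V s t κ) {i j : Fin n} (hij : i ≠ j) (hi : i ∈ V)
    (hj : j ∈ V) (R : Type u) [CommRing R] [IsDomain R] [Algebra F R] (x : Fin n → R) :
    IsSquare (rayleigh a i j (mixedPoint V s t κ x)) := by
  obtain ⟨ι, h1, h2, lam, v, W, hW, h⟩ := h
  set P := mixedPoint V s t κ x
  have hz : ∀ z w : R, mixedPoint V s t κ (update (update x i z) j w) =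
      update (update P i (z, 1)) j (w, 1) := by
    intro z w
    funext l
    by_cases hl : l = j
    · subst hl; simp [mixedPoint, hj]
    · by_cases hl' : l = i
      · subst hl'; simp [mixedPoint, hi, hl]
      · simp [mixedPoint, hl, hl', P]
  have hd := dodgson (pencil v W (update (update x i 0) j 0)) (pencil_isSymm v W hW _)
    (algebraMap F R ∘ v i) (algebraMap F R ∘ v j)
    (fun z w => (pencil v W (update (update x i z) j w)).det) (by
      intro z w
      rw [pencil_update, update_comm hij, pencil_update, update_comm hij.symm])
  -- The four values at `z, w ∈ {0, 1}` determine the four coefficients entering the Rayleigh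
  -- difference.
  have e : ∀ z w : R, z * (w * ev a (update (update P i (1, 0)) j (1, 0)) +
      ev a (update (update P i (1, 0)) j (0, 1))) +
      (w * ev a (update (update P i (0, 1)) j (1, 0)) +
        ev a (update (update P i (0, 1)) j (0, 1))) =
      algebraMap F R lam * (pencil v W (update (update x i z) j w)).det := by
    intro z w
    have e2 : ∀ y, ev a (update (update P i (z, 1)) j y) =
        z * ev a (update (update P i (1, 0)) j y) + 1 * ev a (update (update P i (0, 1)) j y) := by
      intro y
      rw [update_comm hij, ev_update a _ i z, update_comm hij.symm, update_comm hij.symm]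
    rw [← h, hz, ev_update a _ j w, e2, e2]
    ring
  refine ⟨algebraMap F R lam * (algebraMap F R ∘ v i ⬝ᵥ
    (pencil v W (update (update x i 0) j 0)).adjugate.mulVec (algebraMap F R ∘ v j)), ?_⟩
  have e00 := e 0 0
  have e01 := e 0 1
  have e10 := e 1 0
  have e11 := e 1 1
  generalize (algebraMap F R ∘ v i ⬝ᵥ
    (pencil v W (update (update x i 0) j 0)).adjugate.mulVec (algebraMap F R ∘ v j)) = g at *
  rw [rayleigh]
  generalize ev a (update (update P i (1, 0)) j (1, 0)) = A at *
  generalize ev a (update (update P i (1, 0)) j (0, 1)) = B at *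
  generalize ev a (update (update P i (0, 1)) j (1, 0)) = C at *
  generalize ev a (update (update P i (0, 1)) j (0, 1)) = D at *
  generalize (pencil v W (update (update x i 0) j 0)).det = d00 at *
  generalize (pencil v W (update (update x i 0) j 1)).det = d01 at *
  generalize (pencil v W (update (update x i 1) j 0)).det = d10 at *
  generalize (pencil v W (update (update x i 1) j 1)).det = d11 at *
  have hD : D = algebraMap F R lam * d00 := by linear_combination e00
  have hC : C = algebraMap F R lam * (d01 - d00) := by linear_combination e01 - e00
  have hB : B = algebraMap F R lam * (d10 - d00) := by linear_combination e10 - e00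
  have hA : A = algebraMap F R lam * (d11 - d10 - d01 + d00) := by
    linear_combination e11 - e01 - e10 + e00
  rw [hA, hB, hC, hD]
  linear_combination algebraMap F R lam ^ 2 * hd

theorem IsDeterminantal.squareCondition {a : Finset (Fin n) → F}
    (h : IsDeterminantal (multiaffinePoly a)) : SquareCondition a := by
  intro i j hij S hi hj
  -- The slots other than `i, j` are frozen at the corner of `S`.
  have := ((h.hasPencil (fun l => if l ∈ S then 0 else 1) (fun l => if l ∈ S then 1 else 0)
    0).mono {i, j} (Finset.subset_univ _)).isSquare_rayleigh hij (by simp) (by simp) F 0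
  rwa [rayleigh_congr a i j (Q := corner F S), rayleigh_corner a hij hi hj] at this
  intro l hli hlj
  simp only [mixedPoint, corner]
  split_ifs <;> simp_all

theorem sq_of_isSquare_quadratic {R : Type*} [CommRing R] [IsDomain R] (A B C : R)
    (h : IsSquare (Polynomial.C A * Polynomial.X ^ 2 + Polynomial.C B * Polynomial.X +
      Polynomial.C C)) : B ^ 2 - 4 * A * C = 0 := by
  obtain ⟨g, hg⟩ := h
  have hdeg : g.natDegree ≤ 1 := by
    have h1 := congrArg Polynomial.natDegree hg
    rw [← pow_two, Polynomial.natDegree_pow] at h1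
    have h2 := Polynomial.natDegree_quadratic_le (a := A) (b := B) (c := C)
    omega
  obtain ⟨p, q, rfl⟩ := Polynomial.exists_eq_X_add_C_of_natDegree_le_one hdeg
  have h0 := congrArg (fun p => Polynomial.coeff p 0) hg
  have h1 := congrArg (fun p => Polynomial.coeff p 1) hg
  have h2 := congrArg (fun p => Polynomial.coeff p 2) hg
  have e : (Polynomial.C p * Polynomial.X + Polynomial.C q) *
      (Polynomial.C p * Polynomial.X + Polynomial.C q) = Polynomial.C (p * p) * Polynomial.X ^ 2 +
      Polynomial.C (2 * (p * q)) * Polynomial.X + Polynomial.C (q * q) := by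
    simp only [map_mul, Polynomial.C_ofNat]
    ring
  rw [e] at h0 h1 h2
  simp only [Polynomial.coeff_add, Polynomial.coeff_C_mul, Polynomial.coeff_X_pow,
    Polynomial.coeff_X, Polynomial.coeff_C] at h0 h1 h2
  norm_num at h0 h1 h2
  rw [h0, h1, h2]
  ring

theorem IsDeterminantal.hypDetCondition {a : Finset (Fin n) → F}
    (h : IsDeterminantal (multiaffinePoly a)) : HypDetCondition a := by
  rw [hypDetCondition_iff]
  intro i j k hij hik hjk P
  -- All slots but `i, j, k` are frozen at `P`. The Rayleigh difference ignores slots `i, j`, so a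
  -- single indeterminate, playing `x_k`, is enough.
  have := ((h.hasPencil (fun l => (P l).1) (fun l => (P l).2) 0).mono {i, j, k}
    (Finset.subset_univ _)).isSquare_rayleigh hij (by simp) (by simp) (Polynomial F)
    (fun _ => Polynomial.X)
  rw [hyperdet_eq_discrim a P hik hjk]
  let Q : Fin n → Polynomial F × Polynomial F :=
    fun l => (algebraMap F _ (P l).1, algebraMap F _ (P l).2)
  have hP : rayleigh a i j (mixedPoint {i, j, k} (fun l => (P l).1) (fun l => (P l).2) 0
      (fun _ => Polynomial.X)) = rayleigh a i j (update Q k (Polynomial.X, 1)) := by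
    have : ∀ z w, update (update (mixedPoint {i, j, k} (fun l => (P l).1) (fun l => (P l).2) 0
        (fun _ => (Polynomial.X : Polynomial F))) i z) j w =
        update (update (update Q k (Polynomial.X, 1)) i z) j w := by
      intro z w
      funext l
      simp only [update_apply, mixedPoint, Q]
      split_ifs <;> simp_all
    simp only [rayleigh, this]
  rw [hP, rayleigh_update a Q hik hjk] at this
  have hQ : ∀ x y z : F × F, algebraMap F (Polynomial F) (slot3 a i j k P x y z) =
      slot3 a i j k Q (algebraMap F _ x.1, algebraMap F _ x.2)
      (algebraMap F _ y.1, algebraMap F _ y.2) (algebraMap F _ z.1, algebraMap F _ z.2) := by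
    exact slot3_algebraMap a P
  apply sq_of_isSquare_quadratic
  simp only [mul_one, one_pow] at this
  refine (congrArg IsSquare ?_).mpr this
  simp only [← Polynomial.algebraMap_eq, rayleigh_update_eq_slot3 a _ hik hjk, rayleighMid, map_add,
    map_sub, map_mul, hQ, map_one, map_zero]

end

end MultiaffineDet

/-! ### From the conditions to square Rayleigh differences over every domain -/

namespace MultiaffineDet

open MvPolynomial Function

noncomputable section

universe u

variable {F : Type u} [Field F] {n : ℕ}

/-- Fields with two or four elements have characteristic 2, so three is the only small order left to
exclude. -/
theorem exists_five_of_card_ne_three (h3 : Nat.card F ≠ 3) (h2 : (2 : F) ≠ 0) :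
    ∃ s : Finset F, s.card = 5 := by
  cases finite_or_infinite F with
  | inr h => exact Infinite.exists_subset_card_eq F 5
  | inl h =>
    have := Fintype.ofFinite F
    rw [Nat.card_eq_fintype_card] at h3
    have hc : ((Fintype.card F : ℕ) : F) = 0 := Nat.cast_card_eq_zero F
    have h1 : 1 < Fintype.card F := Fintype.one_lt_card
    have h5 : 5 ≤ (Finset.univ : Finset F).card := by
      rw [Finset.card_univ]
      by_contra! hlt
      interval_cases hh : Fintype.card F
      · exact h2 (by exact_mod_cast hc)
      · exact h3 rfl
      · apply h2
        have : (2 : F) * 2 = 0 := by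
          have : ((4 : ℕ) : F) = 0 := hc
          norm_num at this ⊢
          exact this
        simpa using this
    obtain ⟨s, -, hs⟩ := Finset.exists_subset_card_eq h5
    exact ⟨s, hs⟩

theorem map_cayley {R S : Type*} [CommRing R] [CommRing S] (φ : R →+* S)
    (t₀ t₁ t₂ t₃ t₁₂ t₁₃ t₂₃ t₁₂₃ : R) : φ (cayley t₀ t₁ t₂ t₃ t₁₂ t₁₃ t₂₃ t₁₂₃) =
      cayley (φ t₀) (φ t₁) (φ t₂) (φ t₃) (φ t₁₂) (φ t₁₃) (φ t₂₃) (φ t₁₂₃) := by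
  have h2 : φ 2 = 2 := map_ofNat φ 2
  have h4 : φ 4 = 4 := map_ofNat φ 4
  simp only [cayley, map_add, map_sub, map_mul, map_pow, h2, h4]

/-- Along a line the hyperdeterminant is a polynomial of degree at most four, so five zeros in `F`
force it to vanish identically. -/
theorem cayley_affine_eq_zero {R : Type*} [CommRing R] [IsDomain R] [Algebra F R]
    {s : Finset F} (hs : s.card = 5) (b c : Fin 8 → R)
    (h : ∀ z : F, cayley (b 0 * algebraMap F R z + c 0) (b 1 * algebraMap F R z + c 1)
      (b 2 * algebraMap F R z + c 2) (b 3 * algebraMap F R z + c 3)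
      (b 4 * algebraMap F R z + c 4) (b 5 * algebraMap F R z + c 5)
      (b 6 * algebraMap F R z + c 6) (b 7 * algebraMap F R z + c 7) = 0) (y : R) :
    cayley (b 0 * y + c 0) (b 1 * y + c 1) (b 2 * y + c 2) (b 3 * y + c 3)
      (b 4 * y + c 4) (b 5 * y + c 5) (b 6 * y + c 6) (b 7 * y + c 7) = 0 := by
  let q : Fin 8 → Polynomial R := fun m => Polynomial.C (b m) * Polynomial.X + Polynomial.C (c m)
  let p : Polynomial R := cayley (q 0) (q 1) (q 2) (q 3) (q 4) (q 5) (q 6) (q 7)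
  have he : ∀ y, p.eval y = cayley (b 0 * y + c 0) (b 1 * y + c 1) (b 2 * y + c 2)
      (b 3 * y + c 3) (b 4 * y + c 4) (b 5 * y + c 5) (b 6 * y + c 6) (b 7 * y + c 7) := by
    intro y
    simp [p, cayley, q]
  have hdeg : p.natDegree ≤ 4 := by
    simp only [p, cayley, q]
    compute_degree
  have hp : p = 0 := by
    refine Polynomial.eq_zero_of_natDegree_lt_card_of_eval_eq_zero' p
      (s.map ⟨algebraMap F R, (algebraMap F R).injective⟩) ?_ ?_
    · intro z hz
      obtain ⟨z, -, rfl⟩ := Finset.mem_map.1 hz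
      rw [he]
      exact h z
    · rw [Finset.card_map, hs]
      omega
  rw [← he, hp, Polynomial.eval_zero]

section Domain

variable {R : Type*} [CommRing R] [Algebra F R]

theorem eq_zero_of_slotwise (Φ : (Fin n → R × R) → R)
    (h0 : ∀ p : Fin n → F × F, Φ (fun l => (algebraMap F R (p l).1, algebraMap F R (p l).2)) = 0)
    (hs : ∀ P l, (∀ s t : F, Φ (update P l (algebraMap F R s, algebraMap F R t)) = 0) → Φ P = 0)
    (P : Fin n → R × R) : Φ P = 0 := by
  have key : ∀ V : Finset (Fin n), ∀ P : Fin n → R × R,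
      (∀ l ∉ V, ∃ p : F × F, P l = (algebraMap F R p.1, algebraMap F R p.2)) → Φ P = 0 := by
    intro V
    induction V using Finset.induction_on with
    | empty =>
      intro P hP
      choose p hp using fun l => hP l (Finset.notMem_empty l)
      rw [show P = _ from funext hp]
      exact h0 p
    | insert k V hk ih =>
      intro P hP
      refine hs P k fun s t => ih _ fun l hl => ?_
      by_cases hlk : l = k
      · subst hlk
        exact ⟨(s, t), by simp⟩
      · rw [update_of_ne hlk]
        exact hP l (by simp [hl, hlk])
  exact key Finset.univ P fun l hl => absurd (Finset.mem_univ l) hl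

variable {a : Finset (Fin n) → F}

theorem hyperdet_eq_zero_of_card [IsDomain R] (h3 : Nat.card F ≠ 3) (h2 : (2 : F) ≠ 0) {i j k : Fin n}
    (h : ∀ P : Fin n → F × F, hyperdet a i j k P = 0) (P : Fin n → R × R) :
    hyperdet a i j k P = 0 := by
  obtain ⟨s, hs⟩ := exists_five_of_card_ne_three h3 h2
  refine eq_zero_of_slotwise (F := F) _ (fun p => ?_) (fun P l hl => ?_) P
  · have := congrArg (algebraMap F R) (h p)
    simpa [hyperdet, hyperdetAt, map_cayley, slot3_algebraMap] using this
  · by_cases hm : l = i ∨ l = j ∨ l = k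
    · have := hl 0 0
      simp only [hyperdet, hyperdetAt, slot3_update_of_mem a _ l hm] at this
      exact this
    · push Not at hm
      obtain ⟨hi, hj, hk⟩ := hm
      let T : R × R → Fin 8 → R := fun w => ![slot3 a i j k (update P l w) (1, 0) (1, 0) (1, 0),
        slot3 a i j k (update P l w) (0, 1) (1, 0) (1, 0),
        slot3 a i j k (update P l w) (1, 0) (0, 1) (1, 0),
        slot3 a i j k (update P l w) (1, 0) (1, 0) (0, 1),
        slot3 a i j k (update P l w) (0, 1) (0, 1) (1, 0),
        slot3 a i j k (update P l w) (0, 1) (1, 0) (0, 1),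
        slot3 a i j k (update P l w) (1, 0) (0, 1) (0, 1),
        slot3 a i j k (update P l w) (0, 1) (0, 1) (0, 1)]
      have hT : ∀ x y : R, hyperdet a i j k (update P l (x, y)) =
          cayley (T (1, 0) 0 * x + T (0, 1) 0 * y) (T (1, 0) 1 * x + T (0, 1) 1 * y)
            (T (1, 0) 2 * x + T (0, 1) 2 * y) (T (1, 0) 3 * x + T (0, 1) 3 * y)
            (T (1, 0) 4 * x + T (0, 1) 4 * y) (T (1, 0) 5 * x + T (0, 1) 5 * y)
            (T (1, 0) 6 * x + T (0, 1) 6 * y) (T (1, 0) 7 * x + T (0, 1) 7 * y) := by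
        intro x y
        simp only [hyperdet, hyperdetAt, slot3_update a P hi hj hk x y, mul_comm x, mul_comm y]
        rfl
      -- The two coordinates of the slot are freed one after the other.
      have e1 : ∀ (x : R) (t : F), hyperdet a i j k (update P l (x, algebraMap F R t)) = 0 := by
        intro x t
        rw [hT]
        exact cayley_affine_eq_zero hs (T (1, 0)) (fun m => T (0, 1) m * algebraMap F R t)
          (fun z => by rw [← hT]; exact hl z t) x
      have e2 : ∀ x y : R, hyperdet a i j k (update P l (x, y)) = 0 := by
        intro x y
        have := cayley_affine_eq_zero hs (T (0, 1)) (fun m => T (1, 0) m * x) (fun z => by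
          have := e1 x z
          rw [hT] at this
          simpa only [add_comm (T (0, 1) _ * _)] using this) y
        rw [hT]
        simpa only [add_comm (T (0, 1) _ * _)] using this
      have := e2 (P l).1 (P l).2
      rwa [Prod.mk.eta, update_eq_self] at this

/-- In characteristic 2 the discriminant is the square of the middle coefficient. That coefficient
is only a quadratic form in each further slot, so the three points `(1, 0)`, `(0, 1)`, `(1, 1)`
suffice, even over the field with two elements. -/
theorem rayleighMid_eq_zero_of_two_eq_zero (h2 : (2 : F) = 0) {i j k : Fin n}
    (hik : i ≠ k) (hjk : j ≠ k)
    (h : ∀ P : Fin n → F × F, hyperdet a i j k P = 0) (P : Fin n → R × R) :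
    rayleighMid a i j k P = 0 := by
  refine eq_zero_of_slotwise (F := F) _ (fun p => ?_) (fun P l hl => ?_) P
  · have h4 : (4 : F) = 0 := by linear_combination 2 * h2
    have := h p
    rw [hyperdet_eq_discrim a p hik hjk, h4] at this
    simp only [zero_mul, sub_zero] at this
    have := congrArg (algebraMap F R) (pow_eq_zero_iff two_ne_zero |>.1 this)
    simpa [rayleighMid, slot3_algebraMap] using this
  · by_cases hm : l = i ∨ l = j ∨ l = k
    · have := hl 0 0
      simp only [rayleighMid, slot3_update_of_mem a _ l hm] at this
      exact this
    · push Not at hm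
      obtain ⟨hi, hj, hk⟩ := hm
      have hT : ∃ β : R, ∀ x y : R, rayleighMid a i j k (update P l (x, y)) =
          rayleighMid a i j k (update P l (1, 0)) * x ^ 2 + β * (x * y) +
            rayleighMid a i j k (update P l (0, 1)) * y ^ 2 := by
        refine ⟨rayleighMid a i j k (update P l (1, 1)) - rayleighMid a i j k (update P l (1, 0)) -
          rayleighMid a i j k (update P l (0, 1)), fun x y => ?_⟩
        simp only [rayleighMid, slot3_update a P hi hj hk x y, slot3_update a P hi hj hk 1 1]
        ring
      obtain ⟨β, hT⟩ := hT
      have h10 := hl 1 0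
      have h01 := hl 0 1
      have h11 := hl 1 1
      simp only [map_one, map_zero] at h10 h01 h11
      have := hT (P l).1 (P l).2
      rw [hT, h10, h01] at h11
      have hβ : β = 0 := by linear_combination h11
      rw [Prod.mk.eta, update_eq_self, h10, h01, hβ] at this
      rw [this]
      ring

theorem isSquare_rayleigh_of_conditions [IsDomain R] (hF : Nat.card F ≠ 3) (hs : SquareCondition a)
    (hd : HypDetCondition a) {i j : Fin n} (hij : i ≠ j) (P : Fin n → R × R) :
    IsSquare (rayleigh a i j P) := by
  rw [hypDetCondition_iff] at hd
  have key : ∀ V : Finset (Fin n), ∀ P : Fin n → R × R,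
      (∀ l ∉ V, P l = (1, 0) ∨ P l = (0, 1)) → IsSquare (rayleigh a i j P) := by
    intro V
    induction V using Finset.induction_on with
    | empty =>
      intro P hP
      classical
      let S : Finset (Fin n) := {l | l ≠ i ∧ l ≠ j ∧ P l = (0, 1)}
      rw [rayleigh_congr a i j (Q := corner R S), rayleigh_corner a hij (by simp [S]) (by simp [S])]
      · exact (hs i j hij S (by simp [S]) (by simp [S])).map (algebraMap F R)
      · intro l hi hj
        rcases hP l (Finset.notMem_empty l) with h | h <;> simp [corner, S, hi, hj, h]
    | insert k V hk ih =>
      intro P hP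
      have hsub : ∀ w : R × R, w = (1, 0) ∨ w = (0, 1) →
          ∀ l ∉ V, update P k w l = (1, 0) ∨ update P k w l = (0, 1) := by
        intro w hw l hl
        by_cases hlk : l = k
        · subst hlk; simpa using hw
        · rw [update_of_ne hlk]
          exact hP l (by simp [hl, hlk])
      have hA := ih (update P k (1, 0)) (hsub _ (Or.inl rfl))
      have hC := ih (update P k (0, 1)) (hsub _ (Or.inr rfl))
      by_cases hki : k = i
      · rwa [rayleigh_congr a i j (Q := P)
          fun l h _ => update_of_ne (hki ▸ h) _ _] at hA
      by_cases hkj : k = j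
      · rwa [rayleigh_congr a i j (Q := P)
          fun l _ h => update_of_ne (hkj ▸ h) _ _] at hA
      have hik : i ≠ k := Ne.symm hki
      have hjk : j ≠ k := Ne.symm hkj
      have hr := rayleigh_update a P hik hjk (P k).1 (P k).2
      rw [Prod.mk.eta, update_eq_self] at hr
      obtain ⟨g, hg⟩ := hA
      obtain ⟨h, hh⟩ := hC
      -- With vanishing discriminant, `B² = 4 g² h²`; in characteristic 2 this is replaced by `B =
      -- 0`.
      have hB : rayleighMid a i j k P = 2 * (g * h) ∨ rayleighMid a i j k P = -(2 * (g * h)) := by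
        by_cases h2 : (2 : F) = 0
        · left
          rw [rayleighMid_eq_zero_of_two_eq_zero h2 hik hjk (hd i j k hij hik hjk)]
          have : (2 : R) = 0 := by
            rw [← map_ofNat (algebraMap F R) 2, h2, map_zero]
          rw [this, zero_mul]
        · have := hyperdet_eq_zero_of_card hF h2 (hd i j k hij hik hjk) P
          rw [hyperdet_eq_discrim a P hik hjk, hg, hh] at this
          apply sq_eq_sq_iff_eq_or_eq_neg.1
          linear_combination this
      rw [hr, hg, hh]
      rcases hB with hB | hB
      · exact ⟨g * (P k).1 + h * (P k).2, by rw [hB]; ring⟩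
      · exact ⟨g * (P k).1 - h * (P k).2, by rw [hB]; ring⟩
  exact key Finset.univ P fun l hl => absurd (Finset.mem_univ l) hl

end Domain

end

end MultiaffineDet

/-! ### Degrees in single variables, and determinants of matrices of rank one modulo `f` -/

namespace MultiaffineDet

open MvPolynomial Function

noncomputable section

universe u

variable {F : Type u} [Field F] {n : ℕ}

section Degree

variable {p q : MvPolynomial (Fin n) F} {i j l : Fin n}

theorem degreeOf_mul_eq_zero (hp : degreeOf i p = 0) (hq : degreeOf i q = 0) :
    degreeOf i (p * q) = 0 := by
  have := degreeOf_mul_le i p q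
  omega

theorem degreeOf_sub_eq_zero (hp : degreeOf i p = 0) (hq : degreeOf i q = 0) :
    degreeOf i (p - q) = 0 := by
  have := degreeOf_sub_le i p q
  simpa [hp, hq] using this

theorem coeff_eq_zero_of_degreeOf_lt {m : Fin n →₀ ℕ} (h : degreeOf i p < m i) :
    coeff m p = 0 := by
  by_contra hc
  exact absurd (le_degreeOf_of_mem_support i (mem_support_iff.2 hc)) (not_le.2 h)

theorem pderiv_eq_zero_of_degreeOf (h : degreeOf i p = 0) : pderiv i p = 0 :=
  pderiv_eq_zero_of_notMem_vars fun hi => (mem_vars_iff_degreeOf_ne_zero.1 hi) h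

theorem degreeOf_pderiv_le : degreeOf l (pderiv i p) ≤ degreeOf l p := by
  rw [degreeOf_le_iff]
  intro m hm
  rw [mem_support_iff, coeff_pderiv] at hm
  have := le_degreeOf_of_mem_support l (mem_support_iff.2 (left_ne_zero_of_mul hm))
  rw [Finsupp.add_apply] at this
  omega

theorem degreeOf_pderiv_self (h : degreeOf i p ≤ 1) : degreeOf i (pderiv i p) = 0 := by
  rw [← Nat.le_zero, degreeOf_le_iff]
  intro m hm
  rw [mem_support_iff, coeff_pderiv] at hm
  have := le_degreeOf_of_mem_support i (mem_support_iff.2 (left_ne_zero_of_mul hm))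
  simp at this
  omega

theorem degreeOf_sub_X_mul_pderiv (h : degreeOf i p ≤ 1) :
    degreeOf i (p - X i * pderiv i p) = 0 := by
  rw [← Nat.le_zero, degreeOf_le_iff]
  intro m hm
  by_contra hmi
  rw [mem_support_iff] at hm
  apply hm
  have hle : Finsupp.single i 1 ≤ m := by
    rw [Finsupp.single_le_iff]
    omega
  obtain ⟨m', rfl⟩ := exists_add_of_le hle
  rw [coeff_sub, coeff_X_mul, coeff_pderiv, add_comm m']
  by_cases h0 : m' i = 0
  · simp [h0]
  · rw [coeff_eq_zero_of_degreeOf_lt (i := i)]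
    · simp
    · simp
      omega

theorem pderiv_comm' (i j : Fin n) (p : MvPolynomial (Fin n) F) :
    pderiv i (pderiv j p) = pderiv j (pderiv i p) := by
  ext m
  by_cases h : i = j
  · rw [h]
  · simp only [coeff_pderiv, Finsupp.add_apply, Finsupp.single_apply, h, Ne.symm h, if_false,
      add_right_comm m]
    push_cast
    ring

theorem eq_C_of_degreeOf (h : ∀ i, degreeOf i p = 0) : p = C (coeff 0 p) := by
  rw [← vars_eq_empty_iff_eq_C, Finset.eq_empty_iff_forall_notMem]
  exact fun i hi => mem_vars_iff_degreeOf_ne_zero.1 hi (h i)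

theorem exists_eq_X_mul_add (h : degreeOf i p ≤ 1) (h' : ∀ l, l ≠ i → degreeOf l p = 0) :
    ∃ c d : F, p = C d + X i * C c := by
  have h1 := eq_C_of_degreeOf (p := pderiv i p) fun l => by
    by_cases hl : l = i
    · subst hl; exact degreeOf_pderiv_self h
    · have := degreeOf_pderiv_le (l := l) (i := i) (p := p)
      rw [h' l hl] at this
      omega
  have h2 := eq_C_of_degreeOf (p := p - X i * pderiv i p) fun l => by
    by_cases hl : l = i
    · subst hl; exact degreeOf_sub_X_mul_pderiv h
    · refine degreeOf_sub_eq_zero (h' l hl) (degreeOf_mul_eq_zero (degreeOf_X_of_ne hl) ?_)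
      have := degreeOf_pderiv_le (l := l) (i := i) (p := p)
      rw [h' l hl] at this
      omega
  exact ⟨coeff 0 (pderiv i p), coeff 0 (p - X i * pderiv i p), by rw [← h1, ← h2]; ring⟩

theorem degreeOf_of_sq_eq {d : ℕ} (h : degreeOf i (p * p) ≤ 2 * d) : degreeOf i p ≤ d := by
  by_cases hp : p = 0
  · simp [hp]
  · rw [degreeOf_mul_eq hp hp] at h
    omega

theorem degreeOf_det_le {ι : Type*} [Fintype ι] [DecidableEq ι]
    (B : Matrix ι ι (MvPolynomial (Fin n) F)) (d : ι → ℕ)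
    (h : ∀ r c, degreeOf l (B r c) ≤ d r) : degreeOf l B.det ≤ ∑ r, d r := by
  rw [← Matrix.det_transpose, Matrix.det_apply]
  refine (degreeOf_sum_le _ _ _).trans (Finset.sup_le fun σ _ => ?_)
  have : degreeOf l (∏ r, B.transpose (σ r) r) ≤ ∑ r, d r :=
    (degreeOf_prod_le _ _ _).trans (Finset.sum_le_sum fun r _ => h r (σ r))
  rcases Int.units_eq_one_or (Equiv.Perm.sign σ) with hs | hs <;> rw [hs]
  · simpa using this
  · simpa using this

/-- The Rayleigh difference of a polynomial. -/
def rayleighDiff (i j : Fin n) (f : MvPolynomial (Fin n) F) : MvPolynomial (Fin n) F :=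
  pderiv i f * pderiv j f - f * pderiv j (pderiv i f)

theorem rayleighDiff_comm (f : MvPolynomial (Fin n) F) :
    rayleighDiff i j f = rayleighDiff j i f := by
  rw [rayleighDiff, rayleighDiff, pderiv_comm', mul_comm (pderiv i f)]

theorem degreeOf_rayleighDiff_le (f : MvPolynomial (Fin n) F) :
    degreeOf l (rayleighDiff i j f) ≤ 2 * degreeOf l f := by
  refine (degreeOf_sub_le _ _ _).trans (max_le ?_ ?_)
  · have h1 := degreeOf_mul_le l (pderiv i f) (pderiv j f)
    have h2 := degreeOf_pderiv_le (l := l) (i := i) (p := f)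
    have h3 := degreeOf_pderiv_le (l := l) (i := j) (p := f)
    omega
  · have h1 := degreeOf_mul_le l f (pderiv j (pderiv i f))
    have h2 := degreeOf_pderiv_le (l := l) (i := i) (p := f)
    have h3 := degreeOf_pderiv_le (l := l) (i := j) (p := pderiv i f)
    omega

/-- With `f = x_i a + b` and `a, b` free of `x_i`, the Rayleigh difference is `a ∂_j b - b ∂_j a`.
-/
theorem degreeOf_rayleighDiff_left (hij : i ≠ j) {f : MvPolynomial (Fin n) F}
    (h : degreeOf i f ≤ 1) : degreeOf i (rayleighDiff i j f) = 0 := by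
  have hb := degreeOf_sub_X_mul_pderiv h
  have hd := degreeOf_pderiv_self h
  set b := f - X i * pderiv i f with hbdef
  have hj : pderiv j f = X i * pderiv j (pderiv i f) + pderiv j b := by
    rw [hbdef, map_sub, Derivation.leibniz, pderiv_X_of_ne hij]
    simp
  have hle : ∀ q : MvPolynomial (Fin n) F, degreeOf i q = 0 → degreeOf i (pderiv j q) = 0 :=
    fun q hq => by
      have := degreeOf_pderiv_le (l := i) (i := j) (p := q)
      omega
  have : rayleighDiff i j f = pderiv i f * pderiv j b - b * pderiv j (pderiv i f) := by
    rw [rayleighDiff, hj, hbdef]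
    ring
  rw [this]
  exact degreeOf_sub_eq_zero (degreeOf_mul_eq_zero hd (hle _ hb))
    (degreeOf_mul_eq_zero hb (hle _ hd))

theorem degreeOf_rayleighDiff_right (hij : i ≠ j) {f : MvPolynomial (Fin n) F}
    (h : degreeOf j f ≤ 1) : degreeOf j (rayleighDiff i j f) = 0 := by
  rw [rayleighDiff_comm]
  exact degreeOf_rayleighDiff_left hij.symm h

end Degree

section RankOne

variable {R : Type*} [CommRing R] {ι : Type*} [Fintype ι] [DecidableEq ι]

/-- Bordering by `1`, `u` and `-w` absorbs the rank-one part, so the rows in `T` become `f N` apart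
from the new column. Multiplying that column by `f` costs one factor `f` and makes each row in `T`
divisible by `f`. -/
theorem pow_card_dvd_mul_det (B N : Matrix ι ι R) (f : R) (w u : ι → R) (T : Finset ι)
    (h : ∀ r ∈ T, ∀ c, B r c = f * N r c + w r * u c) : f ^ T.card ∣ f * B.det := by
  let w' : ι → R := fun r => if r ∈ T then w r else 0
  let D : Matrix ι ι R := Matrix.of fun r c => if r ∈ T then f * N r c else B r c
  let D' : Matrix ι ι R := Matrix.of fun r c => if r ∈ T then N r c else B r c
  let E : Matrix (Unit ⊕ ι) (Unit ⊕ ι) R := Matrix.fromBlocks 1 (Matrix.replicateRow Unit u)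
    (Matrix.replicateCol Unit (-w')) D
  let E' : Matrix (Unit ⊕ ι) (Unit ⊕ ι) R := Matrix.fromBlocks (f • 1) (Matrix.replicateRow Unit u)
    (Matrix.replicateCol Unit (-w')) D'
  have h1 : B.det = E.det := by
    rw [Matrix.det_fromBlocks_one₁₁]
    congr 1
    ext r c
    by_cases hr : r ∈ T
    · simp [D, w', hr, Matrix.mul_apply, h r hr c]
    · simp [D, w', hr, Matrix.mul_apply]
  have h2 := Matrix.det_mul_row (Sum.elim (fun _ => f) fun _ => 1) E
  have h3 := Matrix.det_mul_column (Sum.elim (fun _ => 1) fun r => if r ∈ T then f else 1) E'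
  rw [Fintype.prod_sum_type] at h2 h3
  simp only [Sum.elim_inl, Sum.elim_inr, Finset.prod_const_one, mul_one, Finset.univ_unique,
    Finset.prod_const, Finset.card_singleton, pow_one, one_mul] at h2 h3
  have h4 : (∏ r, if r ∈ T then f else 1) = f ^ T.card := by
    rw [Finset.prod_ite_mem, Finset.univ_inter, Finset.prod_const]
  rw [h1, ← h2, ← h4]
  refine Dvd.intro _ (h3.symm.trans ?_)
  congr 1
  ext (r | r) (c | c)
  · simp [E, E']
  · simp [E, E']
  · by_cases hr : r ∈ T <;> simp [E, E', w', hr]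
  · by_cases hr : r ∈ T <;> simp [E, E', D, D', hr]

end RankOne

end

end MultiaffineDet

/-! ### The matrix of coherent square roots -/

namespace MultiaffineDet

open MvPolynomial Function

noncomputable section

universe u

variable {F : Type u} [Field F] {n : ℕ}

/-- A determinantal representation in which only the variables of `f` occur. -/
def IsReducedDeterminantal (f : MvPolynomial (Fin n) F) : Prop :=
  ∃ (ι : Type) (_ : Fintype ι) (_ : DecidableEq ι) (lam : F) (v : Fin n → ι → F)
    (W : Matrix ι ι F), W.IsSymm ∧ (∀ i, degreeOf i f = 0 → v i = 0) ∧
      f = C lam * (pencil v W X).det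

/-- The vectors `v_i` are the standard basis vectors for `i ∈ S`; the factor `c` is pulled out of
every row. -/
theorem isReducedDeterminantal_of_matrix {f : MvPolynomial (Fin n) F} (S : Finset (Fin n))
    (hS : ∀ i ∈ S, degreeOf i f ≠ 0) (A : Matrix S S F) (hA : A.IsSymm) (c d : F) (hc : c ≠ 0)
    (hd : d ≠ 0) (h : C d * f = (Matrix.of fun i j : S => C (A i j) +
      if i = j then X (i : Fin n) * C c else 0).det) : IsReducedDeterminantal f := by
  refine ⟨S, inferInstance, inferInstance, d⁻¹ * c ^ Fintype.card S,
    fun l p => if (p : Fin n) = l then 1 else 0, c⁻¹ • A, hA.smul _, ?_, ?_⟩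
  · intro i hi
    funext p
    exact if_neg fun (h : (p : Fin n) = i) => hS i (h ▸ p.2) hi
  · have h1 : (Matrix.of fun i j : S => C (A i j) + if i = j then X (i : Fin n) * C c else 0) =
        (C c : MvPolynomial (Fin n) F) • pencil (fun l (p : S) => if (p : Fin n) = l then 1 else 0)
          (c⁻¹ • A) X := by
      ext1 p q
      rw [Matrix.smul_apply, pencil_apply, Finset.sum_eq_single (p : Fin n)]
      · have e : (C c : MvPolynomial (Fin n) F) * C c⁻¹ = 1 := by
          rw [← C_mul, mul_inv_cancel₀ hc, C_1]
        by_cases hpq : p = q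
        · subst hpq
          simp [MvPolynomial.algebraMap_eq]
          linear_combination -C (A p p) * e
        · have : (q : Fin n) ≠ p := fun h => hpq (Subtype.ext h.symm)
          simp [MvPolynomial.algebraMap_eq, hpq, this]
          linear_combination -C (A p q) * e
      · intro l _ hl
        simp [Ne.symm hl]
      · simp
    rw [h1, Matrix.det_smul] at h
    have e : (C d⁻¹ : MvPolynomial (Fin n) F) * C d = 1 := by
      rw [← C_mul, inv_mul_cancel₀ hd, C_1]
    rw [C_mul, C_pow, mul_assoc, ← h, ← mul_assoc, e, one_mul]

section Core

variable {f : MvPolynomial (Fin n) F} {e : Fin n →₀ ℕ}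

theorem degreeOf_eq_of_coeff_ne_zero (hdeg : ∀ i, degreeOf i f ≤ e i) (hc : coeff e f ≠ 0)
    (i : Fin n) : degreeOf i f = e i :=
  le_antisymm (hdeg i) (le_degreeOf_of_mem_support i (mem_support_iff.2 hc))

theorem coeff_X_mul_pderiv {i : Fin n} (hi : degreeOf i f ≤ 1) (hei : e i = 1) :
    coeff e (X i * pderiv i f) = coeff e f := by
  have h1 := coeff_eq_zero_of_degreeOf_lt (m := e)
    (show degreeOf i (f - X i * pderiv i f) < e i by rw [degreeOf_sub_X_mul_pderiv hi]; omega)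
  rw [coeff_sub, sub_eq_zero] at h1
  exact h1.symm

/-- A system of square roots of Rayleigh differences, made coherent modulo an irreducible `f`. -/
theorem exists_coherent_roots (hf : Irreducible f) (he : ∀ i, e i ≤ 1)
    (hdeg : ∀ i, degreeOf i f ≤ e i)
    (hsq : ∀ i j, i ≠ j → IsSquare (rayleighDiff i j f)) (i₀ : Fin n) :
    ∃ (w : Fin n → MvPolynomial (Fin n) F) (G : Fin n → Fin n → MvPolynomial (Fin n) F),
      (∀ i j, G i j = G j i) ∧ (∀ i, G i i = pderiv i f) ∧
      (∀ i j, f ∣ pderiv i₀ f * G i j - w i * w j) ∧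
      (∀ i j, degreeOf i (G i j) = 0) ∧ (∀ i j l, degreeOf l (G i j) ≤ e l) := by
  have hdeg1 : ∀ i, degreeOf i f ≤ 1 := fun i => (hdeg i).trans (he i)
  -- `w i` is a square root of `∂_{i₀} f ∂_i f` modulo `f`. The rank-one condition relative to `w`
  -- fixes the sign of each root.
  have hw : ∀ i, ∃ w r, w * w = pderiv i₀ f * pderiv i f - f * r := by
    intro i
    by_cases hi : i = i₀
    · subst hi
      exact ⟨pderiv i f, 0, by ring⟩
    · obtain ⟨g, hg⟩ := hsq i₀ i (Ne.symm hi)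
      exact ⟨g, _, hg.symm⟩
  choose w r hwr using hw
  have hg : ∀ i j, ∃ g, (i = j → g = pderiv i f) ∧ f ∣ pderiv i₀ f * g - w i * w j ∧
      degreeOf i g = 0 ∧ degreeOf j g = 0 ∧ ∀ l, degreeOf l g ≤ e l := by
    intro i j
    by_cases hij : i = j
    · subst hij
      exact ⟨pderiv i f, fun _ => rfl, ⟨r i, by rw [hwr]; ring⟩, degreeOf_pderiv_self (hdeg1 i),
        degreeOf_pderiv_self (hdeg1 i), fun l => degreeOf_pderiv_le.trans (hdeg l)⟩
    · obtain ⟨g, hg⟩ := hsq i j hij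
      have hd : ∀ l, degreeOf l g ≤ e l := fun l => degreeOf_of_sq_eq (by
        rw [← hg]
        exact degreeOf_rayleighDiff_le f |>.trans (Nat.mul_le_mul_left 2 (hdeg l)))
      have hdi : degreeOf i g = 0 := Nat.le_zero.1 (degreeOf_of_sq_eq (by
        rw [← hg, degreeOf_rayleighDiff_left hij (hdeg1 i)]))
      have hdj : degreeOf j g = 0 := Nat.le_zero.1 (degreeOf_of_sq_eq (by
        rw [← hg, degreeOf_rayleighDiff_right hij (hdeg1 j)]))
      -- The product is `w_i² w_j² - (∂_{i₀} f)² g²`, and both terms are `(∂_{i₀} f)² ∂_i f ∂_j f`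
      -- modulo `f`. As `f` is prime, `g` or `-g` is the right root.
      have hdvd : f ∣ (pderiv i₀ f * g - w i * w j) * (pderiv i₀ f * -g - w i * w j) := by
        refine ⟨pderiv i₀ f * pderiv i₀ f * pderiv j (pderiv i f) - r i * pderiv i₀ f * pderiv j f -
          r j * pderiv i₀ f * pderiv i f + f * r i * r j, ?_⟩
        rw [rayleighDiff] at hg
        linear_combination pderiv i₀ f * pderiv i₀ f * hg + w j * w j * hwr i +
          (pderiv i₀ f * pderiv i f - f * r i) * hwr j
      rcases hf.prime.dvd_or_dvd hdvd with h | h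
      · exact ⟨g, fun h => absurd h hij, h, hdi, hdj, hd⟩
      · exact ⟨-g, fun h => absurd h hij, h, by rwa [degreeOf_neg], by rwa [degreeOf_neg],
          fun l => by rw [degreeOf_neg]; exact hd l⟩
  choose g hg1 hg2 hg3 hg4 hg5 using hg
  -- The roots were chosen for ordered pairs; taking the sorted pair makes the matrix symmetric.
  refine ⟨w, fun i j => g (min i j) (max i j), fun i j => by dsimp only; rw [min_comm, max_comm],
    fun i => ?_, fun i j => ?_, fun i j => ?_, fun i j l => hg5 _ _ _⟩
  · dsimp only
    rw [min_self, max_self]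
    exact hg1 i i rfl
  · rcases le_total i j with h | h
    · dsimp only
      rw [min_eq_left h, max_eq_right h]
      exact hg2 i j
    · dsimp only
      rw [min_eq_right h, max_eq_left h, mul_comm (w i)]
      exact hg2 j i
  · rcases le_total i j with h | h
    · dsimp only
      rw [min_eq_left h, max_eq_right h]
      exact hg3 i j
    · dsimp only
      rw [min_eq_right h, max_eq_left h]
      exact hg4 j i

theorem sum_degrees_le {g : MvPolynomial (Fin n) F} (d : Fin n → ℕ)
    (h : ∀ l, degreeOf l g ≤ d l) : totalDegree g ≤ ∑ l, d l := by
  rw [totalDegree]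
  refine Finset.sup_le fun m hm => ?_
  rw [Finsupp.sum_fintype _ _ fun _ => rfl]
  exact Finset.sum_le_sum fun l _ => (le_degreeOf_of_mem_support l hm).trans (h l)

/-- `G` is diagonally dominant for total degree: diagonal entries have degree at least `|S| - 1`,
off-diagonal ones at most `|S| - 2`. The row at which a kernel vector has maximal degree gives a
contradiction. -/
theorem det_ne_zero_of_degrees (S : Finset (Fin n)) (heS : ∀ i, e i = if i ∈ S then 1 else 0)
    (hdeg : ∀ i, degreeOf i f ≤ e i) (hc : coeff e f ≠ 0)
    (G : Matrix S S (MvPolynomial (Fin n) F)) (hdiag : ∀ i : S, G i i = pderiv (i : Fin n) f)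
    (hsymm : ∀ i j, G i j = G j i)
    (hG : ∀ i j : S, degreeOf (i : Fin n) (G i j) = 0) (hGe : ∀ i j l, degreeOf l (G i j) ≤ e l) :
    G.det ≠ 0 := by
  classical
  intro h0
  obtain ⟨v, hv, hGv⟩ := Matrix.exists_mulVec_eq_zero_iff.2 h0
  obtain ⟨i₁, hi₁⟩ := Function.ne_iff.1 hv
  obtain ⟨i, hi, hmax⟩ := Finset.exists_max_image (Finset.univ.filter fun i => v i ≠ 0)
    (fun i => totalDegree (v i)) ⟨i₁, by simpa using hi₁⟩
  have hvi : v i ≠ 0 := by simpa using hi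
  have hei : e i = 1 := by rw [heS, if_pos i.2]
  have hsum : ∑ l, e l = S.card := by simp [heS]
  have hcX := coeff_X_mul_pderiv ((hdeg i).trans hei.le) hei
  have hpd : S.card ≤ totalDegree (G i i) + 1 := by
    have h1 : e ∈ (X (i : Fin n) * pderiv (i : Fin n) f).support := by
      rw [mem_support_iff, hcX]
      exact hc
    have h2 := le_totalDegree h1
    rw [Finsupp.sum_fintype _ _ fun _ => rfl, hsum] at h2
    have h3 := totalDegree_mul (X (i : Fin n)) (pderiv (i : Fin n) f)
    rw [totalDegree_X] at h3
    rw [hdiag]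
    omega
  have hGii : G i i ≠ 0 := by
    intro h
    rw [hdiag] at h
    rw [h, mul_zero, coeff_zero] at hcX
    exact hc hcX.symm
  have hoff : ∀ j : S, j ≠ i → totalDegree (G i j) + 2 ≤ S.card := by
    intro j hj
    have hj' : (j : Fin n) ≠ i := fun h => hj (Subtype.ext h)
    have h1 := sum_degrees_le (g := G i j)
      (fun l => if l ∈ (S.erase i).erase (j : Fin n) then 1 else 0) (by
        intro l
        by_cases hlj : l = j
        · rw [hlj, hsymm, hG]; omega
        by_cases hli : l = i
        · rw [hli, hG]; omega
        have := hGe i j l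
        rw [heS] at this
        simpa [hlj, hli] using this)
    rw [Finset.sum_ite_mem, Finset.univ_inter, Finset.sum_const, smul_eq_mul, mul_one,
      Finset.card_erase_of_mem (Finset.mem_erase.2 ⟨hj', j.2⟩), Finset.card_erase_of_mem i.2] at h1
    have : 1 < S.card := Finset.one_lt_card.2 ⟨j, j.2, i, i.2, hj'⟩
    omega
  have hrow : G i i * v i = -∑ j ∈ Finset.univ.erase i, G i j * v j := by
    have := congrFun hGv i
    rw [Matrix.mulVec, dotProduct, ← Finset.add_sum_erase _ _ (Finset.mem_univ i)] at this
    exact eq_neg_of_add_eq_zero_left this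
  have hlhs : totalDegree (G i i * v i) = totalDegree (G i i) + totalDegree (v i) :=
    totalDegree_mul_of_isDomain hGii hvi
  have hne : (Finset.univ.erase i).Nonempty := by
    by_contra hemp
    rw [Finset.not_nonempty_iff_eq_empty] at hemp
    rw [hemp, Finset.sum_empty, neg_zero] at hrow
    exact mul_ne_zero hGii hvi hrow
  obtain ⟨j₀, hj₀⟩ := hne
  have hcard := hoff j₀ (Finset.ne_of_mem_erase hj₀)
  have hrhs : totalDegree (-∑ j ∈ Finset.univ.erase i, G i j * v j) ≤
      S.card - 2 + totalDegree (v i) := by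
    rw [totalDegree_neg]
    refine totalDegree_finsetSum_le fun j hj => ?_
    by_cases hvj : v j = 0
    · simp [hvj]
    · have h1 := totalDegree_mul (G i j) (v j)
      have h2 := hoff j (Finset.ne_of_mem_erase hj)
      have h3 := hmax j (by simpa using hvj)
      omega
  rw [← hrow, hlhs] at hrhs
  omega

end Core

end

end MultiaffineDet

/-! ### Irreducible polynomials -/

namespace MultiaffineDet

open MvPolynomial Function

noncomputable section

universe u

variable {F : Type u} [Field F] {n : ℕ}

section Irreducible

variable {f : MvPolynomial (Fin n) F} {e : Fin n →₀ ℕ}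

/-- The determinant and the adjugate of a matrix of rank one modulo a prime `f`. -/
theorem exists_adjugate_eq_pow_smul {R : Type*} [CommRing R] [IsDomain R] {ι : Type*} [Fintype ι]
    [DecidableEq ι] {f p : R} (hf : Prime f) (hp : ¬ f ∣ p) (G : Matrix ι ι R) (w : ι → R)
    (hG : ∀ i j, f ∣ p * G i j - w i * w j) {k : ℕ} (hk : Fintype.card ι = k + 2) :
    ∃ (M : Matrix ι ι R) (c : R), G.adjugate = f ^ k • M ∧ G.det = f ^ (k + 1) * c := by
  choose N hN using hG
  have hpp : ∀ m, ¬ f ∣ p ^ m := fun m h => hp (hf.dvd_of_dvd_pow h)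
  have hrow : ∀ r c, p * G r c = f * N r c + w r * w c := fun r c => by
    rw [← hN]; ring
  have hdet : f ^ (k + 2) ∣ f * G.det := by
    have h := pow_card_dvd_mul_det (p • G) (Matrix.of N) f w w Finset.univ fun r _ c => hrow r c
    rw [Finset.card_univ, hk, Matrix.det_smul, mul_left_comm] at h
    exact hf.pow_dvd_of_dvd_mul_left _ (hpp _) h
  -- An adjugate entry is the determinant with row `j` replaced by a unit vector; the other `k + 1`
  -- rows are still of rank one modulo `f` after scaling by `p`. The powers of `p` cancel since `f ∤
  -- p`.
  have hadj : ∀ i j, f ^ (k + 1) ∣ f * G.adjugate i j := by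
    intro i j
    have h := pow_card_dvd_mul_det (p • G.updateRow j (Pi.single i 1)) (Matrix.of N) f w w
      (Finset.univ.erase j) fun r hr c => by
        rw [Matrix.smul_apply, Matrix.updateRow_ne (Finset.ne_of_mem_erase hr)]
        exact hrow r c
    rw [Finset.card_erase_of_mem (Finset.mem_univ j), Finset.card_univ, hk, Matrix.det_smul,
      mul_left_comm, ← Matrix.adjugate_apply] at h
    exact hf.pow_dvd_of_dvd_mul_left _ (hpp _) h
  have hadj' : ∀ i j, ∃ M, G.adjugate i j = f ^ k * M := fun i j => by
    have := hadj i j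
    rw [pow_succ', mul_dvd_mul_iff_left hf.ne_zero] at this
    exact this
  choose M hM using hadj'
  rw [pow_succ', mul_dvd_mul_iff_left hf.ne_zero] at hdet
  obtain ⟨c, hc⟩ := hdet
  exact ⟨Matrix.of M, c, by ext i j; simp [hM], hc⟩

theorem degreeOf_of_pow_mul_le {i : Fin n} {g : MvPolynomial (Fin n) F} {k d : ℕ}
    (hf : f ≠ 0) (h : degreeOf i (f ^ k * g) ≤ k * degreeOf i f + d) : degreeOf i g ≤ d := by
  by_cases hg : g = 0
  · simp [hg]
  · rw [degreeOf_mul_eq (pow_ne_zero _ hf) hg, degreeOf_pow_eq _ _ _ hf] at h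
    omega

/-- The representing matrix is `M = adj G / f^k`, where `G` has size `k + 2`. Since `G M = f c`,
taking determinants and using `det G = f^(k+1) c` leaves `det M = f c^(k+1)`. It remains to see that
`M` is `c` times the diagonal matrix of variables plus a constant symmetric matrix. -/
theorem isReducedDeterminantal_of_irreducible (hf : Irreducible f) (he : ∀ i, e i ≤ 1)
    (hdeg : ∀ i, degreeOf i f ≤ e i) (hc : coeff e f ≠ 0)
    (hsq : ∀ i j, i ≠ j → IsSquare (rayleighDiff i j f)) : IsReducedDeterminantal f := by
  classical
  have hf0 : f ≠ 0 := hf.ne_zero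
  have hdegE : ∀ i, degreeOf i f = e i := degreeOf_eq_of_coeff_ne_zero hdeg hc
  let S : Finset (Fin n) := Finset.univ.filter fun i => e i = 1
  have hS : ∀ i, i ∈ S ↔ e i = 1 := fun i => by simp [S]
  have heS : ∀ i, e i = if i ∈ S then 1 else 0 := by
    intro i
    have := he i
    split_ifs with h <;> rw [hS] at h <;> omega
  have hne : S.Nonempty := by
    by_contra hemp
    rw [Finset.not_nonempty_iff_eq_empty] at hemp
    have h1 := eq_C_of_degreeOf (p := f) fun i => by rw [hdegE, heS, hemp]; simp
    apply hf.not_isUnit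
    rw [h1]
    refine (IsUnit.mk0 (coeff 0 f) fun h => hf0 ?_).map C
    rw [h1, h, C_0]
  obtain ⟨i₀, hi₀⟩ := hne
  have hS' : ∀ i ∈ S, degreeOf i f ≠ 0 := fun i hi => by
    rw [hdegE, (hS i).1 hi]
    exact one_ne_zero
  -- The exponent `k = |S| - 2` requires at least two variables; with one, `f` is affine and a `1 ×
  -- 1` matrix works.
  rcases Nat.lt_or_ge S.card 2 with hcard | hcard
  · have hS1 : S = {i₀} := by
      have hpos := Finset.card_pos.2 ⟨i₀, hi₀⟩
      obtain ⟨x, hx⟩ := Finset.card_eq_one.1 (show S.card = 1 by omega)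
      rw [hx, Finset.mem_singleton] at hi₀
      rw [hx, hi₀]
    obtain ⟨c, d, hcd⟩ := exists_eq_X_mul_add ((hdeg i₀).trans (he i₀)) fun l hl => by
      rw [hdegE, heS, hS1, if_neg (by simpa using hl)]
    have hc0 : c ≠ 0 := by
      rintro rfl
      rw [C_0, mul_zero, add_zero] at hcd
      have := hS' i₀ hi₀
      rw [hcd, degreeOf_C] at this
      exact this rfl
    have : Unique S := ⟨⟨⟨i₀, hi₀⟩⟩, fun x =>
      Subtype.ext (Finset.mem_singleton.1 ((Finset.ext_iff.1 hS1 x).1 x.2))⟩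
    refine isReducedDeterminantal_of_matrix S hS' (Matrix.of fun _ _ => d) (by ext; rfl) c 1 hc0
      one_ne_zero ?_
    rw [Matrix.det_unique, Matrix.of_apply, if_pos rfl, Matrix.of_apply, C_1, one_mul]
    have hd : ((default : S) : Fin n) = i₀ :=
      Finset.mem_singleton.1 ((Finset.ext_iff.1 hS1 _).1 (default : S).2)
    rw [hd]
    exact hcd
  obtain ⟨w, G, hsymm, hdiag, hdvd, hG0, hGe⟩ := exists_coherent_roots hf he hdeg hsq i₀
  let G' : Matrix S S (MvPolynomial (Fin n) F) := Matrix.of fun i j => G i j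
  have hdetG : G'.det ≠ 0 := det_ne_zero_of_degrees S heS hdeg hc G' (fun i => hdiag i)
    (fun i j => hsymm i j) (fun i j => hG0 i j) fun i j l => hGe i j l
  have hp0 : pderiv i₀ f ≠ 0 := by
    intro h
    have := coeff_X_mul_pderiv ((hdeg i₀).trans (he i₀)) ((hS i₀).1 hi₀)
    rw [h, mul_zero, coeff_zero] at this
    exact hc this.symm
  have hp : ¬ f ∣ pderiv i₀ f := by
    rintro ⟨h, hh⟩
    have hh0 : h ≠ 0 := by
      rintro rfl
      rw [mul_zero] at hh
      exact hp0 hh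
    have := congrArg (degreeOf i₀) hh
    rw [degreeOf_pderiv_self ((hdeg i₀).trans (he i₀)), degreeOf_mul_eq hf0 hh0] at this
    have := hS' i₀ hi₀
    omega
  obtain ⟨k, hk⟩ := Nat.exists_eq_add_of_le' hcard
  have hk' : Fintype.card S = k + 2 := by rw [Fintype.card_coe, hk]
  obtain ⟨M, c, hM, hcdet⟩ := exists_adjugate_eq_pow_smul hf.prime hp G' (fun i => w i)
    (fun i j => hdvd i j) hk'
  have hfk : f ^ k ≠ 0 := pow_ne_zero _ hf0
  have hGM : G' * M = (f * c) • (1 : Matrix S S (MvPolynomial (Fin n) F)) := by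
    have h1 := Matrix.mul_adjugate G'
    rw [hM, hcdet, Matrix.mul_smul] at h1
    ext1 i j
    have h2 := congrFun (congrFun h1 i) j
    simp only [Matrix.smul_apply, smul_eq_mul] at h2 ⊢
    apply mul_left_cancel₀ hfk
    rw [h2]
    ring
  have hMsymm : ∀ i j, M i j = M j i := by
    intro i j
    have h1 : G'.transpose = G' := by ext i j; exact congrArg _ (hsymm j i)
    have h2 := Matrix.adjugate_transpose G'
    rw [h1, hM] at h2
    have h3 := congrFun (congrFun h2 j) i
    simp only [Matrix.smul_apply, smul_eq_mul, Matrix.transpose_apply] at h3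
    exact mul_left_cancel₀ hfk h3
  have hrow : ∀ (l : Fin n) (r c : S), degreeOf l (G' r c) ≤ if (r : Fin n) = l then 0 else e l := by
    intro l r c
    split_ifs with h
    · rw [← h]
      exact (hG0 r c).le
    · exact hGe r c l
  -- In the determinant for `adj G`, the replaced row `j` and the row `l` are free of `x_l`, and
  -- every other row has degree at most one. This leaves `k`, or `k + 1` when `j = l`, of which
  -- `f^k` takes `k`.
  have hdegM' : ∀ (i j : S) (l : Fin n), degreeOf l (M i j) ≤ if (j : Fin n) = l then 1 else 0 := by
    intro i j l
    have hadj := congrFun (congrFun hM i) j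
    rw [Matrix.smul_apply, smul_eq_mul] at hadj
    apply degreeOf_of_pow_mul_le hf0 (k := k)
    rw [← hadj, Matrix.adjugate_apply, hdegE]
    refine (degreeOf_det_le _ (fun r => if r = j then 0 else if (r : Fin n) = l then 0 else e l)
      fun r c => ?_).trans ?_
    · by_cases hr : r = j
      · subst hr
        rw [Matrix.updateRow_self, if_pos rfl]
        by_cases hci : c = i
        · subst hci; simp
        · simp [hci]
      · rw [Matrix.updateRow_ne hr, if_neg hr]
        exact hrow l r c
    · by_cases hl : l ∈ S
      · have hsum : ∀ T : Finset S, (∀ r ∉ T, r = j ∨ (r : Fin n) = l) →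
            (∑ r : S, if r = j then 0 else if (r : Fin n) = l then 0 else e l) ≤ T.card * e l := by
          intro T hT
          rw [← Finset.sum_subset (Finset.subset_univ T)]
          · rw [← smul_eq_mul]
            refine Finset.sum_le_card_nsmul _ _ _ fun r _ => ?_
            split_ifs <;> omega
          · intro r _ hr
            rcases hT r hr with h | h <;> simp [h]
        by_cases hjl : (j : Fin n) = l
        · refine (hsum (Finset.univ.erase j) fun r hr => Or.inl (by simpa using hr)).trans ?_
          rw [Finset.card_erase_of_mem (Finset.mem_univ _), Finset.card_univ, hk', if_pos hjl,
            (hS l).1 hl]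
          omega
        · refine (hsum ((Finset.univ.erase j).erase ⟨l, hl⟩) fun r hr => ?_).trans ?_
          · by_contra! h
            apply hr
            simp only [Finset.mem_erase, Finset.mem_univ, and_true]
            exact ⟨fun h' => h.2 (congrArg Subtype.val h'), h.1⟩
          · rw [Finset.card_erase_of_mem (by simpa using fun h => hjl (congrArg Subtype.val h).symm),
              Finset.card_erase_of_mem (Finset.mem_univ _), Finset.card_univ, hk', if_neg hjl]
            simp
      · have : e l = 0 := by rw [heS, if_neg hl]
        simp [this]
  -- By symmetry of `M` the bound also holds with `i` in place of `j`, so off-diagonal entries are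
  -- constant.
  have hdegM : ∀ (i j : S) (l : Fin n), degreeOf l (M i j) ≤
      if i = j ∧ (j : Fin n) = l then 1 else 0 := by
    intro i j l
    have h1 := hdegM' i j l
    have h2 := hdegM' j i l
    rw [hMsymm j i] at h2
    by_cases hj : (j : Fin n) = l
    · by_cases hi : (i : Fin n) = l
      · rw [if_pos ⟨Subtype.ext (hi.trans hj.symm), hj⟩]
        rwa [if_pos hj] at h1
      · rw [if_neg hi] at h2
        omega
    · rw [if_neg hj] at h1
      omega
  -- Only the `k + 1` rows other than `l` contribute to the degree of `det G` in `x_l`, and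
  -- `f^(k+1)` uses all of it.
  have hdegc : ∀ l, degreeOf l c = 0 := by
    intro l
    rw [← Nat.le_zero]
    apply degreeOf_of_pow_mul_le hf0 (k := k + 1)
    rw [← hcdet, hdegE]
    refine (degreeOf_det_le _ (fun r : S => if (r : Fin n) = l then 0 else e l) (hrow l)).trans ?_
    by_cases hl : l ∈ S
    · rw [← Finset.sum_subset (Finset.subset_univ (Finset.univ.erase ⟨l, hl⟩))]
      · refine (Finset.sum_le_card_nsmul _ _ (e l) fun r _ => ?_).trans ?_
        · split_ifs <;> omega
        · rw [Finset.card_erase_of_mem (Finset.mem_univ _), Finset.card_univ, hk', smul_eq_mul]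
          simp
      · intro r _ hr
        have : r = ⟨l, hl⟩ := by simpa using hr
        simp [this]
    · have : e l = 0 := by rw [heS, if_neg hl]
      simp [this]
  obtain ⟨c₀, hc₀⟩ : ∃ c₀, c = C c₀ := ⟨_, eq_C_of_degreeOf hdegc⟩
  have hc₀ne : c₀ ≠ 0 := by
    rintro rfl
    rw [hc₀, C_0, mul_zero] at hcdet
    exact hdetG hcdet
  have hent : ∀ i j : S, ∃ a m : F, M i j = C a + if i = j then X (i : Fin n) * C m else 0 := by
    intro i j
    by_cases hij : i = j
    · subst hij
      obtain ⟨m, a, h⟩ := exists_eq_X_mul_add (p := M i i) (i := (i : Fin n))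
        (by simpa using hdegM i i i) (fun l hl => by
          have := hdegM i i l
          rw [if_neg (by simpa using Ne.symm hl)] at this
          omega)
      exact ⟨a, m, by rw [h, if_pos rfl]⟩
    · refine ⟨coeff 0 (M i j), 0, ?_⟩
      rw [if_neg hij, add_zero]
      exact eq_C_of_degreeOf fun l => by
        have := hdegM i j l
        rw [if_neg (by tauto)] at this
        omega
  choose A m hA using hent
  have hCm : ∀ (q : MvPolynomial (Fin n) F) (b : F), coeff e (q * C b) = coeff e q * b := by
    intro q b
    rw [mul_comm, coeff_C_mul, mul_comm]
  have hG'0 : ∀ i j : S, coeff e (G' i j) = 0 := fun i j =>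
    coeff_eq_zero_of_degreeOf_lt (i := (i : Fin n))
      (by rw [(hS i).1 i.2, Nat.lt_one_iff]; exact hG0 i j)
  -- Compare coefficients of the top monomial in `(G M)_ii = f c`. Row `i` of `G` is free of `x_i`,
  -- so only `∂_i f * x_i m_ii` contributes.
  have hm : ∀ i, m i i = c₀ := by
    intro i
    have hei : e i = 1 := (hS i).1 i.2
    have h1 := congrFun (congrFun hGM i) i
    rw [Matrix.smul_apply, Matrix.one_apply_eq, smul_eq_mul, mul_one, Matrix.mul_apply, hc₀] at h1
    have h2 := congrArg (coeff e) h1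
    rw [hCm, coeff_sum, Finset.sum_eq_single i] at h2
    · rw [hA, if_pos rfl, mul_add, coeff_add, hCm, hG'0] at h2
      have h3 : G' i i * (X (i : Fin n) * C (m i i)) =
          X (i : Fin n) * pderiv (i : Fin n) f * C (m i i) := by
        rw [← hdiag]
        simp only [G', Matrix.of_apply]
        ring
      rw [h3, hCm, coeff_X_mul_pderiv ((hdeg i).trans (he i)) hei, zero_mul, zero_add] at h2
      exact mul_left_cancel₀ hc h2
    · intro j _ hj
      rw [hA, if_neg hj, add_zero, hCm, hG'0, zero_mul]
    · simp
  have hAsymm : (Matrix.of A).IsSymm := by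
    ext i j
    by_cases hij : i = j
    · rw [hij]; rfl
    · have := hMsymm j i
      rw [hA, hA, if_neg hij, if_neg (Ne.symm hij), add_zero, add_zero] at this
      exact C_injective _ _ this
  have hdetM : f * c ^ (k + 1) = M.det := by
    have h1 := congrArg Matrix.det hGM
    rw [Matrix.det_mul, Matrix.det_smul, Matrix.det_one, mul_one, hk', hcdet] at h1
    have hcne : c ≠ 0 := by
      rw [hc₀]
      exact fun h => hc₀ne (C_injective _ _ (h.trans C_0.symm))
    apply mul_left_cancel₀ (mul_ne_zero (pow_ne_zero (k + 1) hf0) hcne)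
    rw [h1]
    ring
  refine isReducedDeterminantal_of_matrix S hS' (Matrix.of A) hAsymm c₀ (c₀ ^ (k + 1)) hc₀ne
    (pow_ne_zero _ hc₀ne) ?_
  rw [C_pow, ← hc₀, mul_comm, hdetM]
  congr 1
  ext1 i j
  rw [hA, Matrix.of_apply, Matrix.of_apply]
  by_cases hij : i = j
  · subst hij
    rw [hm, hc₀]
  · rw [if_neg hij, if_neg hij]

end Irreducible

end

end MultiaffineDet

/-! ### Products of irreducibles, and reduction to a nonzero top coefficient -/

namespace MultiaffineDet

open MvPolynomial Function

noncomputable section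

universe u

variable {F : Type u} [Field F] {n : ℕ}

section Factor

variable {p q : MvPolynomial (Fin n) F}

theorem IsReducedDeterminantal.exists_rep {f : MvPolynomial (Fin n) F}
    (h : IsReducedDeterminantal f) : IsDeterminantal f := by
  obtain ⟨ι, h1, h2, lam, v, W, hW, -, h⟩ := h
  exact (multiaffinePoly_isDeterminantal_iff f).2 ⟨ι, h1, h2, lam, v, W, hW, h⟩

theorem isReducedDeterminantal_C (c : F) :
    IsReducedDeterminantal (C c : MvPolynomial (Fin n) F) :=
  ⟨Empty, inferInstance, inferInstance, c, 0, 0, by ext i; exact i.elim, fun _ _ => rfl, by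
    rw [Matrix.det_isEmpty, mul_one]⟩

/-- The pencils are placed in diagonal blocks. Reducedness is needed here: as the factors share no
variable, each `v_i` lives in one block, so `v_i v_iᵀ` has no off-diagonal blocks. -/
theorem IsReducedDeterminantal.mul (hp0 : p ≠ 0) (hq0 : q ≠ 0)
    (hdeg : ∀ i, degreeOf i p + degreeOf i q ≤ 1)
    (hp : IsReducedDeterminantal p) (hq : IsReducedDeterminantal q) :
    IsReducedDeterminantal (p * q) := by
  obtain ⟨ι, h1, h2, lam, v, W, hW, hv, h⟩ := hp
  obtain ⟨ι', h1', h2', lam', v', W', hW', hv', h'⟩ := hq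
  refine ⟨ι ⊕ ι', inferInstance, inferInstance, lam * lam', fun i => Sum.elim (v i) (v' i),
    Matrix.fromBlocks W 0 0 W', hW.fromBlocks (by simp) hW', fun i hi => ?_, ?_⟩
  · rw [degreeOf_mul_eq hp0 hq0] at hi
    funext x
    dsimp only
    rw [hv i (by omega), hv' i (by omega)]
    cases x <;> rfl
  · have hb : pencil (fun i => Sum.elim (v i) (v' i)) (Matrix.fromBlocks W 0 0 W')
        (X : Fin n → MvPolynomial (Fin n) F) =
        Matrix.fromBlocks (pencil v W X) 0 0 (pencil v' W' X) := by
      have hz : ∀ i, v i = 0 ∨ v' i = 0 := fun i => by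
        have := hdeg i
        by_cases h0 : degreeOf i p = 0
        · exact Or.inl (hv i h0)
        · exact Or.inr (hv' i (by omega))
      ext1 (x | x) (y | y)
      · simp [pencil_apply]
      · rw [pencil_apply, Finset.sum_eq_zero]
        · simp
        · intro i _
          rcases hz i with h | h <;> simp [h]
      · rw [pencil_apply, Finset.sum_eq_zero]
        · simp
        · intro i _
          rcases hz i with h | h <;> simp [h]
      · simp [pencil_apply]
    rw [hb, Matrix.det_fromBlocks_zero₂₁, C_mul]
    nth_rewrite 1 [h, h']
    ring

theorem isSquare_of_sq_mul {R : Type*} [CommRing R] [IsDomain R] [IsIntegrallyClosed R]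
    {g d : R} (hg : g ≠ 0) (h : IsSquare (g ^ 2 * d)) : IsSquare d := by
  obtain ⟨r, hr⟩ := h
  have hdvd : g ^ 2 ∣ r ^ 2 := ⟨d, by rw [hr, pow_two]⟩
  rw [IsIntegrallyClosed.pow_dvd_pow_iff two_ne_zero] at hdvd
  obtain ⟨s, rfl⟩ := hdvd
  refine ⟨s, mul_left_cancel₀ (pow_ne_zero 2 hg) ?_⟩
  rw [hr]
  ring

/-- If `p` lacks `x_i` or `x_j`, its Rayleigh difference is zero. Otherwise `q` lacks both and
factors out as `q²`, which can be cancelled because the polynomial ring is integrally closed. -/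
theorem isSquare_rayleighDiff_of_mul (hp0 : p ≠ 0) (hq0 : q ≠ 0)
    (hdeg : ∀ i, degreeOf i (p * q) ≤ 1) {i j : Fin n}
    (h : IsSquare (rayleighDiff i j (p * q))) : IsSquare (rayleighDiff i j p) := by
  have hd : ∀ i, degreeOf i p + degreeOf i q ≤ 1 := fun i => by
    rw [← degreeOf_mul_eq hp0 hq0]
    exact hdeg i
  by_cases hi : degreeOf i p = 0
  · rw [rayleighDiff, pderiv_eq_zero_of_degreeOf hi]
    simp
  by_cases hj : degreeOf j p = 0
  · rw [rayleighDiff_comm, rayleighDiff, pderiv_eq_zero_of_degreeOf hj]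
    simp
  have hqi : pderiv i q = 0 := pderiv_eq_zero_of_degreeOf (by have := hd i; omega)
  have hqj : pderiv j q = 0 := pderiv_eq_zero_of_degreeOf (by have := hd j; omega)
  have : rayleighDiff i j (p * q) = q ^ 2 * rayleighDiff i j p := by
    simp only [rayleighDiff, pderiv_mul, hqi, hqj, mul_zero, add_zero]
    ring
  rw [this] at h
  exact isSquare_of_sq_mul hq0 h

theorem exists_top_exponents_of_mul (hp0 : p ≠ 0) (hq0 : q ≠ 0) {e : Fin n →₀ ℕ}
    (hdeg : ∀ i, degreeOf i (p * q) ≤ e i) (hc : coeff e (p * q) ≠ 0) :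
    ∃ α β : Fin n →₀ ℕ, α + β = e ∧ (∀ i, degreeOf i p ≤ α i) ∧ (∀ i, degreeOf i q ≤ β i) ∧
      coeff α p ≠ 0 ∧ coeff β q ≠ 0 := by
  rw [coeff_mul] at hc
  obtain ⟨⟨α, β⟩, hαβ, hne⟩ := Finset.exists_ne_zero_of_sum_ne_zero hc
  rw [Finset.HasAntidiagonal.mem_antidiagonal] at hαβ
  have hα := left_ne_zero_of_mul hne
  have hβ := right_ne_zero_of_mul hne
  have key : ∀ i, degreeOf i p ≤ α i ∧ degreeOf i q ≤ β i := by
    intro i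
    have h1 := hdeg i
    have h2 := le_degreeOf_of_mem_support i (mem_support_iff.2 hα)
    have h3 := le_degreeOf_of_mem_support i (mem_support_iff.2 hβ)
    rw [degreeOf_mul_eq hp0 hq0, ← hαβ, Finsupp.add_apply] at h1
    dsimp only at h1 h2 h3
    omega
  exact ⟨α, β, hαβ, fun i => (key i).1, fun i => (key i).2, hα, hβ⟩

theorem isReducedDeterminantal_of_isSquare (f : MvPolynomial (Fin n) F) :
    ∀ e : Fin n →₀ ℕ, (∀ i, e i ≤ 1) → (∀ i, degreeOf i f ≤ e i) → coeff e f ≠ 0 →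
      (∀ i j, i ≠ j → IsSquare (rayleighDiff i j f)) → IsReducedDeterminantal f := by
  induction f using WfDvdMonoid.induction_on_irreducible with
  | zero => intro e _ _ hc; simp at hc
  | unit u hu =>
    intro e _ _ _ _
    obtain ⟨c, -, rfl⟩ := MvPolynomial.isUnit_iff_eq_C_of_isReduced.1 hu
    exact isReducedDeterminantal_C c
  | mul q p hq0 hp ih =>
    intro e he hdeg hc hsq
    have hp0 := hp.ne_zero
    obtain ⟨α, β, hαβ, hα, hβ, hcα, hcβ⟩ := exists_top_exponents_of_mul hp0 hq0 hdeg hc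
    have hle : ∀ i, α i + β i ≤ 1 := fun i => by
      rw [← Finsupp.add_apply, hαβ]
      exact he i
    have hdeg1 : ∀ i, degreeOf i (p * q) ≤ 1 := fun i => (hdeg i).trans (he i)
    refine IsReducedDeterminantal.mul hp0 hq0
      (fun i => (add_le_add (hα i) (hβ i)).trans (hle i)) ?_ ?_
    · exact isReducedDeterminantal_of_irreducible hp (fun i => (Nat.le_add_right _ _).trans (hle i)) hα hcα
        fun i j hij => isSquare_rayleighDiff_of_mul hp0 hq0 hdeg1 (hsq i j hij)
    · refine ih β (fun i => (Nat.le_add_left _ _).trans (hle i)) hβ hcβ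
        fun i j hij => isSquare_rayleighDiff_of_mul hq0 hp0 (q := p) ?_ ?_
      · simpa only [mul_comm q] using hdeg1
      · simpa only [mul_comm q] using hsq i j hij

end Factor

section Assembly

theorem pderiv_ev_eq_zero (a : Finset (Fin n) → F) (i : Fin n)
    (P : Fin n → MvPolynomial (Fin n) F × MvPolynomial (Fin n) F)
    (h : ∀ l, pderiv i (P l).1 = 0 ∧ pderiv i (P l).2 = 0) : pderiv i (ev a P) = 0 := by
  unfold ev
  rw [map_sum]
  refine Finset.sum_eq_zero fun S _ => ?_
  rw [MvPolynomial.algebraMap_eq, pderiv_C_mul]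
  refine mul_eq_zero_of_right _ ?_
  refine Finset.prod_induction _ (fun p => pderiv i p = 0) (fun p q hp hq => ?_) pderiv_one
    fun l _ => ?_
  · rw [pderiv_mul, hp, hq, zero_mul, mul_zero, add_zero]
  · split_ifs
    · exact (h l).2
    · exact (h l).1

theorem rayleighDiff_multiaffinePoly (a : Finset (Fin n) → F) {i j : Fin n} (hij : i ≠ j) :
    rayleighDiff i j (multiaffinePoly a) = rayleigh a i j (genericPoint F n) := by
  let R := MvPolynomial (Fin n) F
  have hP : ∀ x y : R × R, (pderiv i x.1 = 0 ∧ pderiv i x.2 = 0) →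
      (pderiv i y.1 = 0 ∧ pderiv i y.2 = 0) →
      pderiv i (ev a (update (update (genericPoint F n) i x) j y)) = 0 := by
    intro x y hx hy
    refine pderiv_ev_eq_zero a i _ fun l => ?_
    by_cases hlj : l = j
    · subst hlj; simpa using hy
    · by_cases hli : l = i
      · subst hli; simpa [hlj] using hx
      · rw [update_of_ne hlj, update_of_ne hli]
        simp [genericPoint, pderiv_X_of_ne hli]
  have hP' : ∀ x y : R × R, (pderiv j x.1 = 0 ∧ pderiv j x.2 = 0) →
      (pderiv j y.1 = 0 ∧ pderiv j y.2 = 0) →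
      pderiv j (ev a (update (update (genericPoint F n) i x) j y)) = 0 := by
    intro x y hx hy
    refine pderiv_ev_eq_zero a j _ fun l => ?_
    by_cases hlj : l = j
    · subst hlj; simpa using hy
    · by_cases hli : l = i
      · subst hli; simpa [hlj] using hx
      · rw [update_of_ne hlj, update_of_ne hli]
        simp [genericPoint, pderiv_X_of_ne hlj]
  have hf : multiaffinePoly a =
      X j * (X i * ev a (update (update (genericPoint F n) i (1, 0)) j (1, 0)) +
        ev a (update (update (genericPoint F n) i (0, 1)) j (1, 0))) +
      (X i * ev a (update (update (genericPoint F n) i (1, 0)) j (0, 1)) +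
        ev a (update (update (genericPoint F n) i (0, 1)) j (0, 1))) := by
    have e1 : genericPoint F n = update (update (genericPoint F n) i (X i, 1)) j (X j, 1) := by
      funext l
      by_cases hlj : l = j
      · subst hlj; simp [genericPoint]
      · by_cases hli : l = i
        · subst hli; simp [genericPoint, hlj]
        · rw [update_of_ne hlj, update_of_ne hli]
    rw [multiaffinePoly_eq_ev]
    conv_lhs => rw [e1]
    rw [ev_update a _ j (X j)]
    simp only [update_comm hij]
    rw [ev_update a _ i (X i), ev_update a _ i (X i)]
    ring
  have z0 : ∀ l : Fin n, pderiv l (0 : R) = 0 := fun l => map_zero _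
  have z1 : ∀ l : Fin n, pderiv l (1 : R) = 0 := fun l => pderiv_one
  rw [hf, rayleigh]
  have a1 := hP (1, 0) (1, 0) ⟨z1 i, z0 i⟩ ⟨z1 i, z0 i⟩
  have a2 := hP (1, 0) (0, 1) ⟨z1 i, z0 i⟩ ⟨z0 i, z1 i⟩
  have a3 := hP (0, 1) (1, 0) ⟨z0 i, z1 i⟩ ⟨z1 i, z0 i⟩
  have a4 := hP (0, 1) (0, 1) ⟨z0 i, z1 i⟩ ⟨z0 i, z1 i⟩
  have b1 := hP' (1, 0) (1, 0) ⟨z1 j, z0 j⟩ ⟨z1 j, z0 j⟩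
  have b2 := hP' (1, 0) (0, 1) ⟨z1 j, z0 j⟩ ⟨z0 j, z1 j⟩
  have b3 := hP' (0, 1) (1, 0) ⟨z0 j, z1 j⟩ ⟨z1 j, z0 j⟩
  have b4 := hP' (0, 1) (0, 1) ⟨z0 j, z1 j⟩ ⟨z0 j, z1 j⟩
  generalize ev a (update (update (genericPoint F n) i (1, 0)) j (1, 0)) = A at *
  generalize ev a (update (update (genericPoint F n) i (1, 0)) j (0, 1)) = B at *
  generalize ev a (update (update (genericPoint F n) i (0, 1)) j (1, 0)) = D at *
  generalize ev a (update (update (genericPoint F n) i (0, 1)) j (0, 1)) = E at *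
  have x1 : pderiv i (X j : R) = 0 := pderiv_X_of_ne hij.symm
  have x2 : pderiv j (X i : R) = 0 := pderiv_X_of_ne hij
  simp only [rayleighDiff, map_add, pderiv_mul, a1, a2, a3, a4, b1, b2, b3, b4, x1, x2,
    pderiv_X_self, mul_zero, zero_mul, add_zero, zero_add, one_mul]
  ring

theorem degreeOf_multiaffinePoly_le (a : Finset (Fin n) → F) (i : Fin n) :
    degreeOf i (multiaffinePoly a) ≤ 1 := by
  rw [multiaffinePoly_eq_monomial]
  refine (degreeOf_sum_le _ _ _).trans (Finset.sup_le fun S _ => ?_)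
  rw [degreeOf_le_iff]
  intro m hm
  rw [Finset.mem_singleton.1 (support_monomial_subset hm), sum_single_apply]
  split_ifs <;> simp

theorem isDeterminantal_of_rayleigh_of_ne_zero {a : Finset (Fin n) → F} (h0 : a ∅ ≠ 0)
    (h : ∀ i j, i ≠ j → IsSquare (rayleigh a i j (genericPoint F n))) :
    IsDeterminantal (multiaffinePoly a) := by
  refine (isReducedDeterminantal_of_isSquare _ (∑ i ∈ (∅ : Finset (Fin n))ᶜ, Finsupp.single i 1)
    (fun i => ?_) (fun i => ?_) ?_ fun i j hij => ?_).exists_rep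
  · rw [sum_single_apply]
    split_ifs <;> simp
  · rw [sum_single_apply, if_pos (by simp)]
    exact degreeOf_multiaffinePoly_le a i
  · have := congrFun (coeffVec_multiaffinePoly a) ∅
    rw [coeffVec] at this
    rwa [this]
  · rw [rayleighDiff_multiaffinePoly a hij]
    exact h i j hij

/-- The Rayleigh difference is a `2 × 2` determinant in the slots `i, j`, so it scales by the
determinants of the base changes; the rotation below has determinant one. -/
theorem rayleigh_basis {R : Type*} [CommRing R] [Algebra F R] (a : Finset (Fin n) → F)
    (P : Fin n → R × R) {i j : Fin n} (hij : i ≠ j) (x y z w : R × R) :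
    ev a (update (update P i x) j w) * ev a (update (update P i y) j z) -
      ev a (update (update P i x) j z) * ev a (update (update P i y) j w) =
    (x.1 * y.2 - y.1 * x.2) * (z.1 * w.2 - w.1 * z.2) * rayleigh a i j P := by
  have h : ∀ x z : R × R, ev a (update (update P i x) j z) =
      z.1 * (x.1 * ev a (update (update P i (1, 0)) j (1, 0)) +
        x.2 * ev a (update (update P i (0, 1)) j (1, 0))) +
      z.2 * (x.1 * ev a (update (update P i (1, 0)) j (0, 1)) +
        x.2 * ev a (update (update P i (0, 1)) j (0, 1))) := by
    rintro ⟨x, x'⟩ ⟨z, z'⟩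
    rw [ev_update a _ j z]
    simp only [update_comm hij]
    rw [ev_update a _ i x, ev_update a _ i x]
  rw [h x w, h y z, h x z, h y w, rayleigh]
  ring

theorem isDeterminantal_of_rayleigh {a : Finset (Fin n) → F}
    (h : ∀ i j, i ≠ j → ∀ P : Fin n → MvPolynomial (Fin n) F × MvPolynomial (Fin n) F,
      IsSquare (rayleigh a i j P)) : IsDeterminantal (multiaffinePoly a) := by
  by_cases ha : a = 0
  · refine ⟨0, 0, 0, 0, by ext i; exact i.elim0, ?_⟩
    simp [ha, multiaffinePoly]
  obtain ⟨S, hS⟩ := Function.ne_iff.1 ha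
  -- A quarter turn in the slots of `S` carries the nonzero coefficient `a S` to the top position `b
  -- ∅`.
  let p : Fin n → F × F := fun i => if i ∈ S then (0, 1) else (1, 0)
  let q : Fin n → F × F := fun i => if i ∈ S then (-1, 0) else (0, 1)
  let b : Finset (Fin n) → F := fun T => ev a fun i => if i ∈ T then q i else p i
  let rot : (Fin n → MvPolynomial (Fin n) F × MvPolynomial (Fin n) F) → Fin n →
      MvPolynomial (Fin n) F × MvPolynomial (Fin n) F := fun s i =>
    if i ∈ S then (-(s i).2, (s i).1) else s i
  have hrot : ∀ s, ev b s = ev a (rot s) := by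
    intro s
    rw [← ev_linear]
    congr 1
    funext i
    simp only [p, q, rot]
    split_ifs <;> simp
  have hb0 : b ∅ ≠ 0 := by
    have : b ∅ = ev a (corner F S) := by
      simp only [b, p, Finset.notMem_empty, if_false]
      rfl
    rw [this, ev_corner]
    exact hS
  have hbsq : ∀ i j, i ≠ j → IsSquare (rayleigh b i j (genericPoint F n)) := by
    intro i j hij
    let f : Fin n → MvPolynomial (Fin n) F × MvPolynomial (Fin n) F →
        MvPolynomial (Fin n) F × MvPolynomial (Fin n) F := fun i z => if i ∈ S then (-z.2, z.1) else z
    have hupd : ∀ z w : MvPolynomial (Fin n) F × MvPolynomial (Fin n) F, rot (update (update (genericPoint F n) i z) j w) =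
        update (update (rot (genericPoint F n)) i (f i z)) j (f j w) := by
      intro z w
      funext l
      by_cases hlj : l = j
      · subst hlj; simp [rot, f]
      · by_cases hli : l = i
        · subst hli; simp [rot, f, hlj]
        · simp [rot, hlj, hli]
    have hdet : ∀ i, (f i (1, 0)).1 * (f i (0, 1)).2 - (f i (0, 1)).1 * (f i (1, 0)).2 = 1 := by
      intro i
      simp only [f]
      split_ifs <;> simp
    rw [rayleigh]
    simp only [hrot, hupd]
    rw [rayleigh_basis a _ hij, hdet, hdet, one_mul, one_mul]
    exact h i j hij _
  -- With `s = 1`, `t = 0`, `κ = 1` the slots in `S` become `(1, -x_i)`, which the quarter turn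
  -- sends to `(x_i, 1)`. This undoes the rotation within pencils.
  have hb := ((isDeterminantal_of_rayleigh_of_ne_zero hb0 hbsq).hasPencil (fun _ => 1)
    (fun _ => 0) fun _ => 1).mono Sᶜ (Finset.subset_univ _)
  obtain ⟨ι, h1, h2, lam, v, W, hW, hrep⟩ := hb
  refine (multiaffinePoly_isDeterminantal_iff _).2 ⟨ι, h1, h2, lam, v, W, hW, ?_⟩
  rw [← MvPolynomial.algebraMap_eq, ← hrep (MvPolynomial (Fin n) F) X, hrot, multiaffinePoly_eq_ev]
  congr 1
  funext i
  by_cases hi : i ∈ S <;> simp [rot, mixedPoint, genericPoint, hi]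

end Assembly

end

end MultiaffineDet

theorem corollary6p3 {F : Type*} [Field F] (n : ℕ) (a : Finset (Fin n) → F) :
    (MultiaffineDet.IsDeterminantal (MultiaffineDet.multiaffinePoly a) →
      MultiaffineDet.SquareCondition a ∧ MultiaffineDet.HypDetCondition a) ∧
    (Nat.card F ≠ 3 →
      MultiaffineDet.SquareCondition a ∧ MultiaffineDet.HypDetCondition a →
        MultiaffineDet.IsDeterminantal (MultiaffineDet.multiaffinePoly a)) := by
  refine ⟨fun h => ⟨h.squareCondition, h.hypDetCondition⟩, fun hF h => ?_⟩
  exact MultiaffineDet.isDeterminantal_of_rayleigh fun i j hij P =>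
    MultiaffineDet.isSquare_rayleigh_of_conditions hF h.1 h.2 hij P
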